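/- Let $k$ be a field, let $M$ and $N=\operatorname{Hom}(M,\mathbb Z)$ be dual lattices of rank $d$, and let $\sigma\subset N_{\mathbb R}$ be a strongly convex rational polyhedral cone of dimension $d$. Put $A_{\mathbb R}=\sigma^\vee$, $A=\sigma^\vee\cap M$ and $X=X_\sigma=\operatorname{Spec}k[A]$. For an integer $l\ge 1$ put $(1/l)A=A_{\mathbb R}\cap(1/l)M$ and $X_{(l)}=\operatorname{Spec}k[(1/l)A]$, and let $F^{(l)}\colon X_{(l)}\to X$ be the morphism induced by $A\hookrightarrow(1/l)A$. The $(l)$-th F-blowup $\mathrm{FB}_{(l)}(X)$ is the universal birational flattening of $F^{(l)}$: a variety $Y$ with a proper birational morphism $f\colon Y\to X$ such that $(Y\times_XX_{(l)})_{\mathrm{red}}$ is flat over $Y$, and such that every proper birational morphism $f'\colon Y'\to X$ from a variety with the same flatness property factors uniquely through $f$. The limit F-blowup $\mathrm{FB}_{(\infty)}(X)$ is $\mathrm{FB}_{(l)}(X)$ for all sufficiently large $l$, and the normalized limit F-blowup $\widetilde{\mathrm{FB}}_{(\infty)}(X)$ is its normalization. A toric divisor over $X$ is a torus-invariant prime divisor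 on some normal toric variety $Z$ with a toric birational morphism $Z\to X$; two of them are identified if they have the same valuation ring in the function field of $X$. It appears on a variety $Z'$ birational over $X$ as a prime divisor if the local ring of $Z'$ at some point of codimension one equals this valuation ring. The toric resolutions of $X$ are the morphisms $X_\Sigma\to X$ for the fans $\Sigma$ of smooth cones with support $\sigma$. A toric divisor over $X$ is BGS essential if it appears on every toric resolution of $X$ as a prime divisor. A toric resolution $X_\Sigma\to X$ is moderate if for every $d$-dimensional cone $\tau\in\Sigma$ the linear function $\psi_\tau$ on $N_{\mathbb R}$ that takes the value $1$ on the primitive generators of the rays of $\tau$ satisfies $\psi_\tau\ge0$ on $\sigma$ and $\sigma\cap\{\psi_\tau=0\}=\{0\}$. If $X$ has a moderate toric resolution, then every BGS essential divisor over $X$ appears on $\widetilde{\mathrm{FB}}_{(\infty)}(X)$ as a prime divisor. That is, there is an $l_0\ge1$ such that for every $l\ge l_0$ every BGS essential divisor over $X$ appears as a prime divisor on the normalization of $\mathrm{FB}_{(l)}(X)$. -/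

import Mathlib

open CategoryTheory CategoryTheory.Limits AlgebraicGeometry

universe u

noncomputable section

namespace FBlowup

/-! ### Lattices, cones and fans

The lattices `M` and `N` are both `Fin d → ℤ`, dual to each other through the standard pairing,
and `N_ℝ` is `Fin d → ℝ`. -/

/-- The inclusion `N → N_ℝ`. -/
def toReal {d : ℕ} (n : Fin d → ℤ) : Fin d → ℝ := fun i => (n i : ℝ)

/-- The pairing `(m, x)` of `m ∈ M` with `x ∈ N_ℝ`. -/
def pairing {d : ℕ} (m : Fin d → ℤ) (x : Fin d → ℝ) : ℝ := ∑ i, (m i : ℝ) * x i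

/-- A cone generated by finitely many lattice vectors. -/
def IsRationalPolyhedral {d : ℕ} (τ : PointedCone ℝ (Fin d → ℝ)) : Prop :=
  ∃ s : Finset (Fin d → ℤ), τ = PointedCone.hull ℝ (toReal '' (s : Set (Fin d → ℤ)))

/-- A cone that contains no line. -/
def IsStronglyConvex {d : ℕ} (τ : PointedCone ℝ (Fin d → ℝ)) : Prop :=
  ∀ x ∈ τ, -x ∈ τ → x = 0

/-- A `d`-dimensional cone. -/
def IsNondegenerate {d : ℕ} (τ : PointedCone ℝ (Fin d → ℝ)) : Prop :=
  Submodule.span ℝ (τ : Set (Fin d → ℝ)) = ⊤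

/-- A cone generated by a part of a `ℤ`-basis of `N`. -/
def IsSmoothCone {d : ℕ} (τ : PointedCone ℝ (Fin d → ℝ)) : Prop :=
  ∃ (b : Module.Basis (Fin d) ℤ (Fin d → ℤ)) (s : Set (Fin d)),
    τ = PointedCone.hull ℝ ((fun i => toReal (b i)) '' s)

/-- A fan of rational strongly convex polyhedral cones in `N_ℝ`. -/
structure Fan (d : ℕ) where
  cones : Set (PointedCone ℝ (Fin d → ℝ))
  finite : cones.Finite
  rational : ∀ τ ∈ cones, IsRationalPolyhedral τ
  stronglyConvex : ∀ τ ∈ cones, IsStronglyConvex τ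
  face_mem : ∀ τ ∈ cones, ∀ ρ : PointedCone ℝ (Fin d → ℝ), ρ.IsFaceOf τ → ρ ∈ cones
  inter_face : ∀ τ ∈ cones, ∀ τ' ∈ cones, (τ ⊓ τ').IsFaceOf τ

/-- `Σ` is a subdivision of the cone `σ`: its support is `σ`. -/
def Fan.IsSubdivision {d : ℕ} (S : Fan d) (σ : PointedCone ℝ (Fin d → ℝ)) : Prop :=
  (⋃ τ ∈ S.cones, (τ : Set (Fin d → ℝ))) = (σ : Set (Fin d → ℝ))

/-- A smooth subdivision of `σ`; the morphisms `X_Σ → X_σ` for such `Σ` are the toric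
resolutions of `X_σ`. -/
def Fan.IsSmoothSubdivision {d : ℕ} (S : Fan d) (σ : PointedCone ℝ (Fin d → ℝ)) : Prop :=
  S.IsSubdivision σ ∧ ∀ τ ∈ S.cones, IsSmoothCone τ

/-- For the cone `τ` generated by the basis `b` of `N`, let `ψ_τ` be the linear function that is
`1` on all members of `b`. The hyperplane `ψ_τ = 0` is a supporting hyperplane of the vertex `0`
of `σ`: the cone `σ` lies in `ψ_τ ≥ 0` and meets `ψ_τ = 0` only in the vertex. -/
def SupportsVertex {d : ℕ} (b : Module.Basis (Fin d) ℤ (Fin d → ℤ))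
    (σ : PointedCone ℝ (Fin d → ℝ)) : Prop :=
  ∃ ψ : (Fin d → ℝ) →ₗ[ℝ] ℝ, (∀ i, ψ (toReal (b i)) = 1) ∧
    (∀ x ∈ σ, 0 ≤ ψ x) ∧ ∀ x ∈ σ, ψ x = 0 → x = 0

/-- A moderate smooth subdivision of `σ`: every `d`-dimensional cone `τ` of it is smooth, and
`ψ_τ = 0` is a supporting hyperplane of the vertex of `σ`. -/
def Fan.IsModerate {d : ℕ} (S : Fan d) (σ : PointedCone ℝ (Fin d → ℝ)) : Prop :=
  S.IsSubdivision σ ∧ ∀ τ ∈ S.cones, IsNondegenerate τ →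
    ∃ b : Module.Basis (Fin d) ℤ (Fin d → ℤ),
      τ = PointedCone.hull ℝ (Set.range fun i => toReal (b i)) ∧ SupportsVertex b σ

/-! ### Affine toric varieties -/

/-- The monoid `τ^∨ ∩ M`. -/
def dualMonoid {d : ℕ} (τ : PointedCone ℝ (Fin d → ℝ)) : AddSubmonoid (Fin d → ℤ) where
  carrier := {m | ∀ x ∈ τ, 0 ≤ pairing m x}
  zero_mem' := by
    intro x _
    simp [pairing]
  add_mem' := by
    intro a b ha hb x hx
    have h : pairing (a + b) x = pairing a x + pairing b x := by
      simp [pairing, add_mul, Finset.sum_add_distrib]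
    rw [h]
    exact add_nonneg (ha x hx) (hb x hx)

theorem dualMonoid_anti {d : ℕ} {τ σ : PointedCone ℝ (Fin d → ℝ)} (h : τ ≤ σ) :
    dualMonoid σ ≤ dualMonoid τ :=
  fun _ hm x hx => hm x (h hx)

/-- The monoid algebra `k[τ^∨ ∩ M]`. -/
abbrev coordRing (k : Type u) [Field k] {d : ℕ} (τ : PointedCone ℝ (Fin d → ℝ)) : Type u :=
  AddMonoidAlgebra k (dualMonoid τ)

instance twoUniqueSums_dualMonoid {d : ℕ} (τ : PointedCone ℝ (Fin d → ℝ)) :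
    TwoUniqueSums (dualMonoid τ) :=
  TwoUniqueSums.of_injective_addHom (dualMonoid τ).subtype.toAddHom
    Subtype.val_injective inferInstance

instance isDomain_coordRing (k : Type u) [Field k] {d : ℕ} (τ : PointedCone ℝ (Fin d → ℝ)) :
    IsDomain (coordRing k τ) :=
  NoZeroDivisors.to_isDomain _

/-- The affine toric variety `X_τ = Spec k[τ^∨ ∩ M]`. -/
abbrev toricVariety (k : Type u) [Field k] {d : ℕ} (τ : PointedCone ℝ (Fin d → ℝ)) :
    Scheme.{u} :=
  Spec (CommRingCat.of (coordRing k τ))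

/-- The toric birational morphism `X_τ → X_σ` for `τ ⊆ σ`. -/
def chartMap (k : Type u) [Field k] {d : ℕ} {τ σ : PointedCone ℝ (Fin d → ℝ)} (h : τ ≤ σ) :
    toricVariety k τ ⟶ toricVariety k σ :=
  Spec.map (CommRingCat.ofHom
    (AddMonoidAlgebra.mapDomainRingHom k (AddSubmonoid.inclusion (dualMonoid_anti h))))

/-- The function field of `X_σ`. -/
abbrev functionField (k : Type u) [Field k] {d : ℕ} (σ : PointedCone ℝ (Fin d → ℝ)) : Type u :=
  FractionRing (coordRing k σ)

/-! ### Divisors over `X_σ` and where they appear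

A divisor over `X_σ` is identified with its valuation ring in the function field of `X_σ`. -/

/-- For a birational morphism `π : Z ⟶ X_σ` from an integral scheme and a valuation ring `O` of
the function field: the local ring of `Z` at the point `z`, seen in the function field
of `X_σ`, is `O`. That is to say, there is a morphism `g : Spec O ⟶ Z` that restricts on the
generic point to the inverse of `π` (so it is the inclusion of function fields), sends the closed
point to `z`, and induces an isomorphism of local rings there. -/
def AppearsAt {k : Type u} [Field k] {d : ℕ} {σ : PointedCone ℝ (Fin d → ℝ)} {Z : Scheme.{u}}
    (π : Z ⟶ toricVariety k σ) (O : ValuationSubring (functionField k σ)) (z : Z) : Prop :=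
  ∃ g : Spec (CommRingCat.of O) ⟶ Z,
    Spec.map (CommRingCat.ofHom (algebraMap O (functionField k σ))) ≫ g ≫ π =
        Spec.map (CommRingCat.ofHom (algebraMap (coordRing k σ) (functionField k σ))) ∧
      g (IsLocalRing.closedPoint O) = z ∧
      IsIso (g.stalkMap (IsLocalRing.closedPoint O))

/-- The divisor with valuation ring `O` appears on `Z` as a prime divisor: `O` is the local ring
of `Z` at some point. When `O` is a discrete valuation ring, that point has codimension one, and
the prime divisor is its closure. -/
def AppearsOn {k : Type u} [Field k] {d : ℕ} {σ : PointedCone ℝ (Fin d → ℝ)} {Z : Scheme.{u}}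
    (π : Z ⟶ toricVariety k σ) (O : ValuationSubring (functionField k σ)) : Prop :=
  ∃ z : Z, AppearsAt π O z

/-- A torus-invariant ideal of `k[τ^∨ ∩ M]`, that is, one which contains all the monomials that
occur in its members. -/
def IsTorusInvariant {k : Type u} [Field k] {d : ℕ} {τ : PointedCone ℝ (Fin d → ℝ)}
    (P : Ideal (coordRing k τ)) : Prop :=
  ∀ f ∈ P, ∀ m : dualMonoid τ, f.coeff m ≠ 0 → AddMonoidAlgebra.single m (1 : k) ∈ P

/-- Toric divisors over `X_σ`: torus-invariant prime divisors on normal toric varieties with a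
toric birational morphism to `X_σ`. Such a variety is covered by the affine toric varieties `X_τ`
of strongly convex rational polyhedral cones `τ ⊆ σ`, so the divisor is given by a
torus-invariant prime ideal of height one of some `k[τ^∨ ∩ M]`. -/
def IsToricDivisor {k : Type u} [Field k] {d : ℕ} {σ : PointedCone ℝ (Fin d → ℝ)}
    (O : ValuationSubring (functionField k σ)) : Prop :=
  ∃ (τ : PointedCone ℝ (Fin d → ℝ)) (h : τ ≤ σ) (P : PrimeSpectrum (coordRing k τ)),
    IsRationalPolyhedral τ ∧ IsStronglyConvex τ ∧
      P.asIdeal.height = 1 ∧ IsTorusInvariant P.asIdeal ∧ AppearsAt (chartMap k h) O P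

/-- The divisor with valuation ring `O` appears on the toric variety `X_Σ` of a fan `Σ` with
support in `σ`. As `X_Σ` is the union of its affine open subschemes `X_τ`, `τ ∈ Σ`, this says that
it appears on one of them. -/
def AppearsOnFan {k : Type u} [Field k] {d : ℕ} {σ : PointedCone ℝ (Fin d → ℝ)} (S : Fan d)
    (O : ValuationSubring (functionField k σ)) : Prop :=
  ∃ τ ∈ S.cones, ∃ h : τ ≤ σ, AppearsOn (chartMap k h) O

/-- BGS essential divisors over `X_σ`: the toric divisors that appear on every toric resolution
of `X_σ` as a prime divisor. -/
def IsBGSEssential {k : Type u} [Field k] {d : ℕ} {σ : PointedCone ℝ (Fin d → ℝ)}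
    (O : ValuationSubring (functionField k σ)) : Prop :=
  IsToricDivisor O ∧ ∀ S : Fan d, S.IsSmoothSubdivision σ → AppearsOnFan S O

/-! ### F-blowups -/

/-- The Frobenius-like morphism `F^(l) : X_(l) ⟶ X`, induced by `A ↪ (1/l)A` for
`A = σ^∨ ∩ M`. Multiplication by `l` identifies `(1/l)A` with `A`, hence `X_(l)` with `X_σ`, and
turns the inclusion into `m ↦ l m`. -/
def frobeniusLike (k : Type u) [Field k] {d : ℕ} (σ : PointedCone ℝ (Fin d → ℝ)) (l : ℕ) :
    toricVariety k σ ⟶ toricVariety k σ :=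
  Spec.map (CommRingCat.ofHom
    (AddMonoidAlgebra.mapDomainRingHom k (nsmulAddMonoidHom (α := dualMonoid σ) l)))

/-- `f : Y ⟶ X` is a proper birational morphism from a variety, where `X` is a variety. -/
structure IsProperBirational {X Y : Scheme.{u}} (f : Y ⟶ X) : Prop where
  integral : IsIntegral Y
  proper : IsProper f
  birational : Scheme.BirationalOver f (𝟙 X)

/-- `(Y ×_X W)_red` is flat over `Y`. -/
def ReducedPullbackFlat {X Y W : Scheme.{u}} (f : Y ⟶ X) (F : W ⟶ X) : Prop :=
  Flat ((pullback f F).nilradical.subschemeι ≫ pullback.fst f F)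

/-- `f : Y ⟶ X` is the universal birational flattening of `F : W ⟶ X`. -/
structure IsUniversalBirationalFlattening {X Y W : Scheme.{u}} (f : Y ⟶ X) (F : W ⟶ X) :
    Prop where
  properBirational : IsProperBirational f
  flat : ReducedPullbackFlat f F
  universal : ∀ (Y' : Scheme.{u}) (f' : Y' ⟶ X), IsProperBirational f' →
    ReducedPullbackFlat f' F → ∃! g : Y' ⟶ Y, g ≫ f = f'

/-- `f : Y ⟶ X_σ` is the `(l)`-th F-blowup `FB_(l)(X_σ)`. -/
def IsFBlowup {k : Type u} [Field k] {d : ℕ} {σ : PointedCone ℝ (Fin d → ℝ)} (l : ℕ)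
    {Y : Scheme.{u}} (f : Y ⟶ toricVariety k σ) : Prop :=
  IsUniversalBirationalFlattening f (frobeniusLike k σ l)

/-- The morphism `Ỹ ⟶ Y` from the normalization of an integral scheme: the relative normalization
of `Y` in the spectrum of its function field. -/
def normalizationMap (Y : Scheme.{u}) [IsIntegral Y] [QuasiSeparatedSpace Y] :
    (Y.fromSpecStalk (genericPoint Y)).normalization ⟶ Y :=
  (Y.fromSpecStalk (genericPoint Y)).fromNormalization

end FBlowup

end

noncomputable section

namespace FBlowup

/-! ### Lattice points of the dual cone -/

/-! A moderate subdivision, cut down to the faces of its `d`-dimensional cones, is a toric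
resolution, so an essential divisor with valuation ring `O` appears on it. The divisor then belongs
to a ray, with primitive generator `n`, of a full-dimensional cone with basis `b`. The sum `ψ` of
the dual basis is a lattice point with `ψ ⬝ᵥ n = 1`, and moderateness says that `ψ` is positive on
`σ` away from the vertex.

Combinatorial half. Let `G a` be the least `t` with `a + t ψ` in the dual cone, and let `H` be the
infimum of `G` over translates by `M ∩ n^⊥` (`periodicInf`). Adding `t ψ` lowers both by `t`. If `G
a ≤ 0` and `-1 < H a`, then `a` lies in the dual cone and no point of `a + M` in the cone has a
smaller value on `n`, because `ψ ⬝ᵥ n = 1` turns a drop of the value by `j` into a drop of `H` by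
`j`. The differences of two such points of one class span `M ∩ n^⊥` rationally: otherwise a
functional would be constant on the almost minimal translates along a path from `0` to `ξ ∈ M ∩
n^⊥`, while periodicity shifts it by its value at `ξ` (`exists_translates`). The conditions are
open, so they hold at points of `(1/l)M` for large `l` (`exists_smul_mem_span_minimalTranslations`).

Algebraic half. Let `B` be the ring of an affine open of the blowup around the center of `O`. The
component of `k[(1/l)A]` in the class of `a / l`, divided by the monomial of `a / l`, is
`k[A]`-linear with values in the function field. It extends to the reduced pullback over `B`, and
has values in `O` when `a / l` is minimal on `n`. For two minimal points that differ by `w`,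
flatness applied to the relation between their monomials makes `χ w` a quotient of elements of `B`
with denominator a unit of `O` (`exists_ratio_of_isPushout`).

After normalization, roots may be extracted, so the local ring at the center of `O` contains `χ m`
for all `m` in `n^⊥`. It also contains `χ ψ`, hence `χ m` whenever `m ⬝ᵥ n ≥ 0`, and therefore all
of `O` (`appearsOn_normalizationMap`). -/

theorem pairing_eq_dotProduct {d : ℕ} (m : Fin d → ℤ) (x : Fin d → ℝ) :
    pairing m x = toReal m ⬝ᵥ x := rfl

theorem toReal_dotProduct_toReal {d : ℕ} (m n : Fin d → ℤ) :
    toReal m ⬝ᵥ toReal n = ((m ⬝ᵥ n : ℤ) : ℝ) := by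
  simp [dotProduct, toReal]

theorem toReal_add {d : ℕ} (m n : Fin d → ℤ) : toReal (m + n) = toReal m + toReal n := by
  ext i; simp [toReal]

theorem toReal_neg {d : ℕ} (m : Fin d → ℤ) : toReal (-m) = -toReal m := by
  ext i; simp [toReal]

theorem toReal_sub {d : ℕ} (m n : Fin d → ℤ) : toReal (m - n) = toReal m - toReal n := by
  ext i; simp [toReal]

theorem toReal_zero {d : ℕ} : toReal (0 : Fin d → ℤ) = 0 := by
  ext i; simp [toReal]

theorem toReal_smul {d : ℕ} (z : ℤ) (m : Fin d → ℤ) : toReal (z • m) = (z : ℝ) • toReal m := by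
  ext i; simp [toReal]

theorem toReal_nsmul {d : ℕ} (z : ℕ) (m : Fin d → ℤ) : toReal (z • m) = (z : ℝ) • toReal m := by
  ext i; simp [toReal]

theorem toReal_mem_hull_dotProduct_nonneg {d : ℕ} (s : Set (Fin d → ℝ)) (a : Fin d → ℝ)
    (h : ∀ u ∈ s, 0 ≤ a ⬝ᵥ u) : ∀ x ∈ PointedCone.hull ℝ s, 0 ≤ a ⬝ᵥ x := by
  intro x hx
  induction hx using Submodule.span_induction with
  | mem x hx => exact h x hx
  | zero => simp
  | add x y _ _ hx hy => rw [dotProduct_add]; exact add_nonneg hx hy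
  | smul c x _ hx =>
    have : a ⬝ᵥ (c • x) = (c : ℝ) * (a ⬝ᵥ x) := by
      rw [← smul_eq_mul, ← dotProduct_smul]; rfl
    rw [this]
    exact mul_nonneg c.2 hx

theorem abs_dotProduct_le {d : ℕ} (a x : Fin d → ℝ) :
    |a ⬝ᵥ x| ≤ (∑ i, |x i|) * ‖a‖ := by
  rw [dotProduct, Finset.sum_mul]
  refine (Finset.abs_sum_le_sum_abs _ _).trans (Finset.sum_le_sum fun i _ => ?_)
  rw [abs_mul, mul_comm]
  exact mul_le_mul_of_nonneg_left (norm_le_pi_norm a i) (abs_nonneg _)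

/-- The smallest `t` for which `a + t ψ` lies in the dual cone, as a function of `a`. -/
theorem exists_gauge {d : ℕ} {σ : PointedCone ℝ (Fin d → ℝ)} (hrat : IsRationalPolyhedral σ)
    (ψ : Fin d → ℝ) (hψ : ∀ x ∈ σ, x ≠ 0 → 0 < ψ ⬝ᵥ x) (hne : ∃ x ∈ σ, x ≠ 0) :
    ∃ (G : (Fin d → ℝ) → ℝ) (C : ℝ), 0 < C ∧ (∀ a v, G (a + v) ≤ G a + C * ‖v‖) ∧
      (∀ a (t : ℝ), G (a + t • ψ) = G a - t) ∧ (∀ a, G a ≤ 0 ↔ ∀ x ∈ σ, 0 ≤ a ⬝ᵥ x) := by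
  classical
  obtain ⟨s, rfl⟩ := hrat
  -- `G a` will be the maximum of `-(a ⬝ᵥ u) / (ψ ⬝ᵥ u)` over the nonzero generators `u`; zero
  -- generators impose no condition and would make the denominator vanish.
  set S := (s.image toReal).filter (· ≠ 0) with hS
  have hSσ : ∀ u ∈ S, 0 < ψ ⬝ᵥ u := by
    intro u hu
    rw [hS, Finset.mem_filter, Finset.mem_image] at hu
    obtain ⟨⟨v, hv, rfl⟩, hu0⟩ := hu
    exact hψ _ (PointedCone.subset_hull ⟨v, hv, rfl⟩) hu0
  have hSne : S.Nonempty := by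
    by_contra hemp
    obtain ⟨x, hx, hx0⟩ := hne
    refine hx0 ?_
    have hall : ∀ u ∈ s, toReal u = 0 := by
      intro u hu
      by_contra h0
      exact hemp ⟨toReal u, by simp [hS, h0]; exact ⟨u, hu, rfl⟩⟩
    induction hx using Submodule.span_induction with
    | mem x hx => obtain ⟨v, hv, rfl⟩ := hx; exact hall v hv
    | zero => rfl
    | add x y _ _ hx hy =>
      have hx : x = 0 := by by_contra h; exact h (hx h)
      have hy : y = 0 := by by_contra h; exact h (hy h)
      simp [hx, hy]
    | smul c x _ hx =>
      have hx : x = 0 := by by_contra h; exact h (hx h)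
      simp [hx]
  have hC : ∃ C : ℝ, 0 < C ∧ ∀ u ∈ S, (∑ i, |u i|) / (ψ ⬝ᵥ u) ≤ C := by
    -- The supremum is a Lipschitz constant for the sup norm; the `+ 1` only secures `0 < C`.
    refine ⟨S.sup' hSne (fun u => (∑ i, |u i|) / (ψ ⬝ᵥ u)) + 1, ?_, ?_⟩
    · obtain ⟨u, hu⟩ := hSne
      have h1 : (∑ i, |u i|) / (ψ ⬝ᵥ u) ≤
          S.sup' ⟨u, hu⟩ (fun u => (∑ i, |u i|) / (ψ ⬝ᵥ u)) :=
        Finset.le_sup' (fun u => (∑ i, |u i|) / (ψ ⬝ᵥ u)) hu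
      have h2 : 0 ≤ (∑ i, |u i|) / (ψ ⬝ᵥ u) :=
        div_nonneg (Finset.sum_nonneg fun i _ => abs_nonneg _) (hSσ u hu).le
      linarith
    · intro u hu
      have h1 := Finset.le_sup' (fun u => (∑ i, |u i|) / (ψ ⬝ᵥ u)) hu
      linarith
  obtain ⟨C, hC0, hC⟩ := hC
  refine ⟨fun a => S.sup' hSne (fun u => -(a ⬝ᵥ u) / (ψ ⬝ᵥ u)), C, hC0, ?_, ?_, ?_⟩
  · intro a v
    refine Finset.sup'_le _ _ fun u hu => ?_
    have h1 := Finset.le_sup' (fun u => -(a ⬝ᵥ u) / (ψ ⬝ᵥ u)) hu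
    have h2 : -(v ⬝ᵥ u) / (ψ ⬝ᵥ u) ≤ C * ‖v‖ := by
      calc -(v ⬝ᵥ u) / (ψ ⬝ᵥ u) ≤ ((∑ i, |u i|) * ‖v‖) / (ψ ⬝ᵥ u) := by
            refine div_le_div_of_nonneg_right ?_ (hSσ u hu).le
            exact (neg_le_abs _).trans (abs_dotProduct_le v u)
        _ = ((∑ i, |u i|) / (ψ ⬝ᵥ u)) * ‖v‖ := by ring
        _ ≤ C * ‖v‖ := mul_le_mul_of_nonneg_right (hC u hu) (norm_nonneg _)
    calc -((a + v) ⬝ᵥ u) / (ψ ⬝ᵥ u) = -(a ⬝ᵥ u) / (ψ ⬝ᵥ u) + -(v ⬝ᵥ u) / (ψ ⬝ᵥ u) := by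
          rw [add_dotProduct]; ring
      _ ≤ _ := add_le_add h1 h2
  · intro a t
    have hval : ∀ u ∈ S, -((a + t • ψ) ⬝ᵥ u) / (ψ ⬝ᵥ u) = -(a ⬝ᵥ u) / (ψ ⬝ᵥ u) - t := by
      intro u hu
      have := (hSσ u hu).ne'
      rw [add_dotProduct, smul_dotProduct, smul_eq_mul]
      field_simp
      ring
    refine le_antisymm ?_ ?_
    · refine Finset.sup'_le _ _ fun u hu => ?_
      rw [hval u hu]
      have h1 := Finset.le_sup' (fun u => -(a ⬝ᵥ u) / (ψ ⬝ᵥ u)) hu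
      linarith
    · rw [sub_le_iff_le_add]
      refine Finset.sup'_le _ _ fun u hu => ?_
      have h1 := Finset.le_sup' (fun u => -((a + t • ψ) ⬝ᵥ u) / (ψ ⬝ᵥ u)) hu
      have h2 := hval u hu
      linarith
  · intro a
    rw [Finset.sup'_le_iff]
    constructor
    · intro h
      refine toReal_mem_hull_dotProduct_nonneg _ _ ?_
      rintro _ ⟨u, hu, rfl⟩
      by_cases h0 : toReal u = 0
      · simp [h0]
      · have huS : toReal u ∈ S := by simp [hS, h0]; exact ⟨u, hu, rfl⟩
        have h1 := h _ huS
        rw [div_nonpos_iff] at h1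
        have h2 := hSσ _ huS
        rcases h1 with h1 | h1 <;> linarith
    · intro h u hu
      have hu' := hu
      rw [hS, Finset.mem_filter, Finset.mem_image] at hu
      obtain ⟨⟨v, hv, rfl⟩, hu0⟩ := hu
      have := h _ (PointedCone.subset_hull ⟨v, hv, rfl⟩)
      exact div_nonpos_of_nonpos_of_nonneg (by linarith) (hSσ _ hu').le

/-- The lattice `M ∩ n^⊥`. -/
def orthogonalLattice {d : ℕ} (n : Fin d → ℤ) : AddSubgroup (Fin d → ℤ) where
  carrier := {m | m ⬝ᵥ n = 0}
  zero_mem' := by simp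
  add_mem' := by
    intro a b (ha : a ⬝ᵥ n = 0) (hb : b ⬝ᵥ n = 0)
    change (a + b) ⬝ᵥ n = 0
    rw [add_dotProduct, ha, hb, add_zero]
  neg_mem' := by
    intro a (ha : a ⬝ᵥ n = 0)
    change (-a) ⬝ᵥ n = 0
    rw [neg_dotProduct, ha, neg_zero]

theorem mem_orthogonalLattice {d : ℕ} {n m : Fin d → ℤ} :
    m ∈ orthogonalLattice n ↔ m ⬝ᵥ n = 0 := Iff.rfl

/-- The infimum of a gauge over the translates by `M ∩ n^⊥`. -/
def periodicInf {d : ℕ} (n : Fin d → ℤ) (G : (Fin d → ℝ) → ℝ) (a : Fin d → ℝ) : ℝ :=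
  ⨅ m : orthogonalLattice n, G (a + toReal m)

/-! ### Almost minimal translates -/

section Gauge

variable {d : ℕ} {n : Fin d → ℤ} {ψ : Fin d → ℝ} {G : (Fin d → ℝ) → ℝ} {C : ℝ}

theorem bddBelow_gauge (hlow : ∀ a, -(a ⬝ᵥ toReal n) ≤ G a) (a : Fin d → ℝ) :
    BddBelow (Set.range fun m : orthogonalLattice n => G (a + toReal m)) := by
  refine ⟨-(a ⬝ᵥ toReal n), ?_⟩
  rintro _ ⟨m, rfl⟩
  refine le_trans (le_of_eq ?_) (hlow _)
  have := m.2
  rw [mem_orthogonalLattice] at this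
  rw [add_dotProduct, toReal_dotProduct_toReal, this]
  simp

theorem periodicInf_le (hlow : ∀ a, -(a ⬝ᵥ toReal n) ≤ G a) (a : Fin d → ℝ)
    (m : orthogonalLattice n) : periodicInf n G a ≤ G (a + toReal m) :=
  ciInf_le (bddBelow_gauge hlow a) m

theorem periodicInf_add_le (hlow : ∀ a, -(a ⬝ᵥ toReal n) ≤ G a)
    (hLip : ∀ a v, G (a + v) ≤ G a + C * ‖v‖) (a v : Fin d → ℝ) :
    periodicInf n G (a + v) ≤ periodicInf n G a + C * ‖v‖ := by
  rw [← sub_le_iff_le_add]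
  refine le_ciInf fun m => ?_
  rw [sub_le_iff_le_add]
  refine (periodicInf_le hlow _ m).trans ?_
  have := hLip (a + toReal m) v
  rwa [add_right_comm] at this

theorem periodicInf_add_toReal (hlow : ∀ a, -(a ⬝ᵥ toReal n) ≤ G a) (a : Fin d → ℝ)
    (m : orthogonalLattice n) : periodicInf n G (a + toReal m) = periodicInf n G a := by
  have key : ∀ (a : Fin d → ℝ) (m : orthogonalLattice n),
      periodicInf n G (a + toReal m) ≤ periodicInf n G a := by
    intro a m
    refine le_ciInf fun m' => ?_
    have := periodicInf_le hlow (a + toReal m) (m' - m)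
    rwa [AddSubgroup.coe_sub, toReal_sub, add_assoc, add_sub_cancel] at this
  refine le_antisymm (key a m) ?_
  have := key (a + toReal m) (-m)
  rw [AddSubgroup.coe_neg, toReal_neg] at this
  simpa using this

theorem periodicInf_add_smul (hlow : ∀ a, -(a ⬝ᵥ toReal n) ≤ G a)
    (hs : ∀ a (t : ℝ), G (a + t • ψ) = G a - t) (a : Fin d → ℝ) (t : ℝ) :
    periodicInf n G (a + t • ψ) = periodicInf n G a - t := by
  have key : ∀ (a : Fin d → ℝ) (t : ℝ), periodicInf n G a - t ≤ periodicInf n G (a + t • ψ) := by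
    intro a t
    refine le_ciInf fun m => ?_
    rw [add_right_comm, hs]
    linarith [periodicInf_le hlow a m]
  refine le_antisymm ?_ (key a t)
  have := key (a + t • ψ) (-t)
  rw [add_assoc, ← add_smul] at this
  simp at this
  linarith

/-- Two points of one class of `M_ℝ / M` that are both almost minimal in the direction `n`, and
whose difference is not killed by a given homomorphism. -/
theorem exists_translates (hC : 0 < C) (hlow : ∀ a, -(a ⬝ᵥ toReal n) ≤ G a)
    (hLip : ∀ a v, G (a + v) ≤ G a + C * ‖v‖)
    (hs : ∀ a (t : ℝ), G (a + t • ψ) = G a - t)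
    (x : (Fin d → ℤ) →+ ℝ) (ξ : orthogonalLattice n) (hξ : x ξ ≠ 0) :
    ∃ (a : Fin d → ℝ) (m : orthogonalLattice n), x m ≠ 0 ∧ G a < 0 ∧ G (a + toReal m) < 0 ∧
      -1 < periodicInf n G a := by
  -- Under the negation, `x` takes a single value on the almost minimal translates of each point `c
  -- • ξ`. That value is locally constant in `c`, hence the same at `0` and `1`, whereas periodicity
  -- makes the two values differ by `x ξ`.
  by_contra! hcon
  let p : ℝ → Fin d → ℝ := fun c => c • toReal (ξ : Fin d → ℤ)
  let I : ℝ → Set (orthogonalLattice n) :=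
    fun c => {m | G (p c + toReal m) < periodicInf n G (p c) + 1}
  have hne : ∀ c, ∃ m : orthogonalLattice n,
      G (p c + toReal m) < periodicInf n G (p c) + 1 / 2 := by
    intro c
    exact exists_lt_of_ciInf_lt (by
      change periodicInf n G (p c) < _
      linarith)
  have huniq : ∀ c, ∀ m ∈ I c, ∀ m' ∈ I c, x m = x m' := by
    intro c m hm m' hm'
    have hm₁ : G (p c + toReal m) < periodicInf n G (p c) + 1 := hm
    have hm₂ : G (p c + toReal m') < periodicInf n G (p c) + 1 := hm'
    -- Shifting by this `t` along `ψ` makes both gauges negative and keeps the infimum above `-1`,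
    -- so `hcon` applies to the shifted pair.
    obtain ⟨t, ht1, ht2⟩ := exists_between (max_lt hm₁ hm₂)
    have h1 := lt_of_le_of_lt (le_max_left _ _) ht1
    have h2 := lt_of_le_of_lt (le_max_right _ _) ht1
    by_contra hx
    refine absurd (hcon (p c + toReal m + t • ψ) (m' - m) ?_ ?_ ?_) (not_le.mpr ?_)
    · rw [AddSubgroup.coe_sub, map_sub]
      exact sub_ne_zero.mpr (Ne.symm hx)
    · rw [hs]; linarith
    · have : p c + toReal m + t • ψ + toReal ((m' - m : orthogonalLattice n) : Fin d → ℤ)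
          = p c + toReal m' + t • ψ := by
        rw [AddSubgroup.coe_sub, toReal_sub]; abel
      rw [this, hs]; linarith
    · rw [periodicInf_add_smul hlow hs, periodicInf_add_toReal hlow]; linarith
  have hnorm : 0 < 1 + ‖toReal (ξ : Fin d → ℤ)‖ := by positivity
  -- A step of length `δ` changes `G` and its infimum by at most `1 / 4` each, so a translate within
  -- `1 / 2` of the infimum at `c` is still within `1` of it at `c'`. The `1 +` avoids division by
  -- zero.
  set δ : ℝ := 1 / (4 * C * (1 + ‖toReal (ξ : Fin d → ℤ)‖)) with hδ
  have hδ0 : 0 < δ := by positivity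
  have hclose : ∀ c c', |c - c'| ≤ δ → ∀ m ∈ I c, ∀ m' ∈ I c', x m = x m' := by
    intro c c' hcc m hm m' hm'
    obtain ⟨m₀, hm₀⟩ := hne c
    have hv : C * ‖p c' - p c‖ ≤ 1 / 4 ∧ C * ‖p c - p c'‖ ≤ 1 / 4 := by
      have h1 : ‖p c - p c'‖ ≤ δ * (1 + ‖toReal (ξ : Fin d → ℤ)‖) := by
        change ‖c • _ - c' • _‖ ≤ _
        rw [← sub_smul, norm_smul, Real.norm_eq_abs]
        exact mul_le_mul hcc (by linarith) (norm_nonneg _) hδ0.le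
      have h2 : C * ‖p c - p c'‖ ≤ 1 / 4 := by
        calc C * ‖p c - p c'‖ ≤ C * (δ * (1 + ‖toReal (ξ : Fin d → ℤ)‖)) :=
              mul_le_mul_of_nonneg_left h1 hC.le
          _ = 1 / 4 := by rw [hδ]; field_simp
      exact ⟨by rwa [norm_sub_rev], h2⟩
    have e1 := hLip (p c + toReal m₀) (p c' - p c)
    have e2 := periodicInf_add_le hlow hLip (p c') (p c - p c')
    have e1' : p c + toReal m₀ + (p c' - p c) = p c' + toReal m₀ := by abel
    have e2' : p c' + (p c - p c') = p c := by abel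
    rw [e1'] at e1
    rw [e2'] at e2
    have hm₀' : m₀ ∈ I c' := by
      change G _ < _
      linarith [hv.1, hv.2]
    have hm₀'' : m₀ ∈ I c := by
      change G _ < _
      linarith
    rw [huniq c m hm m₀ hm₀'', huniq c' m₀ hm₀' m' hm']
  choose m₀ hm₀ using hne
  have hm₀I : ∀ c, m₀ c ∈ I c := fun c => by
    change G _ < _
    linarith [hm₀ c]
  have hind : ∀ N : ℕ, x (m₀ (N * δ)) = x (m₀ 0) := by
    intro N
    induction N with
    | zero => simp
    | succ N ih =>
      rw [← ih]
      refine hclose _ _ ?_ _ (hm₀I _) _ (hm₀I _)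
      push_cast
      rw [show ((N : ℝ) + 1) * δ - N * δ = δ by ring, abs_of_pos hδ0]
  have hone : x (m₀ 1) = x (m₀ 0) := by
    rw [← hind ⌊1 / δ⌋₊]
    refine hclose _ _ ?_ _ (hm₀I _) _ (hm₀I _)
    have h1 := Nat.floor_le (show 0 ≤ 1 / δ by positivity)
    have h2 := Nat.lt_floor_add_one (1 / δ)
    rw [le_div_iff₀ hδ0] at h1
    rw [div_lt_iff₀ hδ0] at h2
    rw [abs_of_nonneg (by linarith)]
    linarith
  -- The endpoints differ by the lattice vector `ξ`, so subtracting `ξ` carries almost minimal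
  -- translates at `0` to those at `1`.
  have hshift : m₀ 0 - ξ ∈ I 1 := by
    change G _ < _
    have e : p 1 + toReal ((m₀ 0 - ξ : orthogonalLattice n) : Fin d → ℤ) =
        p 0 + toReal (m₀ 0) := by
      simp [p, toReal_sub]
    have e' : p 1 = p 0 + toReal (ξ : Fin d → ℤ) := by simp [p]
    rw [e, e', periodicInf_add_toReal hlow]
    exact hm₀I 0
  have := huniq 1 _ hshift _ (hm₀I 1)
  rw [hone, AddSubgroup.coe_sub, map_sub] at this
  exact hξ (by linarith)

end Gauge

theorem mem_dualMonoid {d : ℕ} {σ : PointedCone ℝ (Fin d → ℝ)} {m : Fin d → ℤ} :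
    m ∈ dualMonoid σ ↔ ∀ x ∈ σ, 0 ≤ toReal m ⬝ᵥ x := Iff.rfl

/-- The differences `w ∈ M` of pairs `a / l`, `a / l + w` of points of `(1/l)A` that have the
smallest value on `n` in their class modulo `M`. -/
def minimalTranslations {d : ℕ} (σ : PointedCone ℝ (Fin d → ℝ)) (n : Fin d → ℤ) (l : ℕ) :
    Set (Fin d → ℤ) :=
  {w | w ⬝ᵥ n = 0 ∧ ∃ a ∈ dualMonoid σ, a + l • w ∈ dualMonoid σ ∧
    ∀ v, a + l • v ∈ dualMonoid σ → 0 ≤ v ⬝ᵥ n}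

/-- The three hypotheses on `a` are strict and the functions are Lipschitz, so they survive
replacing `a` by a nearby point of `(1/l)M`, obtained by rounding down the coordinates of `l a`. -/
theorem eventually_mem_minimalTranslations {d : ℕ} {σ : PointedCone ℝ (Fin d → ℝ)}
    {n ψ : Fin d → ℤ} (hψn : ψ ⬝ᵥ n = 1) {G : (Fin d → ℝ) → ℝ} {C : ℝ} (hC : 0 < C)
    (hlow : ∀ a, -(a ⬝ᵥ toReal n) ≤ G a) (hLip : ∀ a v, G (a + v) ≤ G a + C * ‖v‖)
    (hs : ∀ a (t : ℝ), G (a + t • toReal ψ) = G a - t)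
    (hG : ∀ a, G a ≤ 0 ↔ ∀ x ∈ σ, 0 ≤ a ⬝ᵥ x)
    {a : Fin d → ℝ} {m : orthogonalLattice n} (ha : G a < 0) (ham : G (a + toReal m) < 0)
    (hH : -1 < periodicInf n G a) :
    ∃ l₀ : ℕ, ∀ l, l₀ ≤ l → (m : Fin d → ℤ) ∈ minimalTranslations σ n l := by
  obtain ⟨ε, hε0, hε1, hε2, hε3⟩ : ∃ ε : ℝ, 0 < ε ∧ C * ε < -G a ∧
      C * ε < -G (a + toReal m) ∧ C * ε < periodicInf n G a + 1 := by
    obtain ⟨ε, h0, h1⟩ := exists_between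
      (show (0 : ℝ) < min (-G a) (min (-G (a + toReal m)) (periodicInf n G a + 1)) by
        refine lt_min (by linarith) (lt_min (by linarith) (by linarith)))
    refine ⟨ε / C, by positivity, ?_⟩
    rw [mul_div_cancel₀ _ hC.ne']
    exact ⟨h1.trans_le (min_le_left _ _),
      h1.trans_le ((min_le_right _ _).trans (min_le_left _ _)),
      h1.trans_le ((min_le_right _ _).trans (min_le_right _ _))⟩
  refine ⟨⌈1 / ε⌉₊ + 1, fun l hl => ?_⟩
  have hl0 : (0 : ℝ) < l := by
    have : 0 < l := by omega
    exact_mod_cast this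
  have hlε : (1 : ℝ) / l ≤ ε := by
    rw [div_le_iff₀ hl0, ← div_le_iff₀' hε0]
    have h2 : (⌈1 / ε⌉₊ : ℝ) ≤ l := by exact_mod_cast (by omega : ⌈1 / ε⌉₊ ≤ l)
    exact (Nat.le_ceil _).trans h2
  let b : Fin d → ℤ := fun i => ⌊(l : ℝ) * a i⌋
  let b' : Fin d → ℝ := (l : ℝ)⁻¹ • toReal b
  have hbb' : toReal b = (l : ℝ) • b' := by
    simp only [b', smul_smul]
    rw [mul_inv_cancel₀ hl0.ne', one_smul]
  have hdist : ‖b' - a‖ ≤ ε := by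
    rw [pi_norm_le_iff_of_nonneg hε0.le]
    intro i
    refine le_trans ?_ hlε
    rw [Real.norm_eq_abs, le_div_iff₀ hl0, ← abs_of_pos hl0, ← abs_mul]
    have : (b' - a) i * l = ⌊(l : ℝ) * a i⌋ - l * a i := by
      simp only [b', b, toReal, Pi.sub_apply, Pi.smul_apply, smul_eq_mul]
      field_simp
    rw [this, abs_le]
    constructor <;> linarith [Int.floor_le ((l : ℝ) * a i), Int.lt_floor_add_one ((l : ℝ) * a i)]
  have hdist' : C * ‖b' - a‖ ≤ C * ε := mul_le_mul_of_nonneg_left hdist hC.le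
  have hmem : ∀ v : Fin d → ℤ, b + l • v ∈ dualMonoid σ ↔ G (b' + toReal v) ≤ 0 := by
    intro v
    rw [hG, mem_dualMonoid]
    refine forall₂_congr fun x _ => ?_
    rw [toReal_add, toReal_nsmul, hbb', ← smul_add, smul_dotProduct, smul_eq_mul,
      mul_nonneg_iff_of_pos_left hl0]
  refine ⟨m.2, b, ?_, ?_, ?_⟩
  · have := (hmem 0).2 ?_
    · simpa using this
    · rw [toReal_zero, add_zero]
      have := hLip a (b' - a)
      rw [add_sub_cancel] at this
      linarith
  · rw [hmem]
    have := hLip (a + toReal m) (b' - a)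
    rw [add_right_comm, add_sub_cancel] at this
    linarith
  · intro v hv
    rw [hmem] at hv
    by_contra hneg
    have hv1 : v ⬝ᵥ n ≤ -1 := by omega
    have hv1' : ((v ⬝ᵥ n : ℤ) : ℝ) ≤ -1 := by exact_mod_cast hv1
    -- Correcting `v` by a multiple of `ψ` moves it into `n^⊥` and lowers the gauge by at least `1`,
    -- which contradicts the bound on the infimum.
    have hm' : v + (-(v ⬝ᵥ n)) • ψ ∈ orthogonalLattice n := by
      rw [mem_orthogonalLattice, add_dotProduct, smul_dotProduct, hψn]
      simp
    have h1 := periodicInf_le hlow b' ⟨_, hm'⟩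
    simp only [toReal_add, toReal_smul, ← add_assoc, hs] at h1
    have h2 := periodicInf_add_le hlow hLip b' (a - b')
    rw [add_sub_cancel, norm_sub_rev] at h2
    push_cast at h1
    linarith

/-- The inclusion of `M` into `M_ℚ`. -/
def toRat {d : ℕ} : (Fin d → ℤ) →+ (Fin d → ℚ) where
  toFun n i := n i
  map_zero' := by ext; simp
  map_add' _ _ := by ext; simp

theorem toRat_injective {d : ℕ} : Function.Injective (toRat (d := d)) := by
  intro a b h
  ext i
  have := congrFun h i
  simpa [toRat] using this

theorem exists_smul_mem_span_of_toRat_mem {d : ℕ} (W : Set (Fin d → ℤ)) {m : Fin d → ℤ}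
    (hm : toRat m ∈ Submodule.span ℚ (toRat '' W)) :
    ∃ N : ℕ, 0 < N ∧ N • m ∈ Submodule.span ℤ W := by
  have key : ∀ y ∈ Submodule.span ℚ (toRat '' W), ∃ N : ℕ, 0 < N ∧
      ∃ w ∈ Submodule.span ℤ W, N • y = toRat w := by
    intro y hy
    induction hy using Submodule.span_induction with
    | mem y hy =>
      obtain ⟨w, hw, rfl⟩ := hy
      exact ⟨1, one_pos, w, Submodule.subset_span hw, one_nsmul _⟩
    | zero => exact ⟨1, one_pos, 0, zero_mem _, by simp⟩
    | add y z _ _ hy hz =>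
      obtain ⟨N, hN, w, hw, h1⟩ := hy
      obtain ⟨N', hN', w', hw', h2⟩ := hz
      refine ⟨N * N', Nat.mul_pos hN hN', N' • w + N • w',
        add_mem (nsmul_mem hw _) (nsmul_mem hw' _), ?_⟩
      rw [map_add, map_nsmul, map_nsmul, ← h1, ← h2, smul_add, smul_smul, smul_smul,
        mul_comm N' N]
    | smul c y _ hy =>
      obtain ⟨N, hN, w, hw, h1⟩ := hy
      refine ⟨N * c.den, Nat.mul_pos hN c.pos, c.num • w, zsmul_mem hw _, ?_⟩
      rw [map_zsmul, ← h1]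
      ext i
      simp only [Pi.smul_apply, smul_eq_mul, nsmul_eq_mul, zsmul_eq_mul, Nat.cast_mul]
      have := Rat.den_mul_eq_num c
      calc (N : ℚ) * c.den * (c * y i) = (c.den * c) * (N * y i) := by ring
        _ = _ := by rw [this]; simp
  obtain ⟨N, hN, w, hw, h⟩ := key _ hm
  refine ⟨N, hN, ?_⟩
  rw [← map_nsmul] at h
  rwa [toRat_injective h]

/-- A rational functional that kills all translations found by `exists_translates` kills `M ∩ n^⊥`,
so these translations span it over `ℚ`; the integers `N` clear denominators. -/
theorem exists_smul_mem_span_minimalTranslations {d : ℕ} {σ : PointedCone ℝ (Fin d → ℝ)}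
    (hrat : IsRationalPolyhedral σ) {n ψ : Fin d → ℤ} (hn : toReal n ∈ σ) (hψn : ψ ⬝ᵥ n = 1)
    (hψ : ∀ x ∈ σ, x ≠ 0 → 0 < toReal ψ ⬝ᵥ x) :
    ∃ l₀ : ℕ, ∀ l, l₀ ≤ l → ∀ m : Fin d → ℤ, m ⬝ᵥ n = 0 →
      ∃ N : ℕ, 0 < N ∧ N • m ∈ Submodule.span ℤ (minimalTranslations σ n l) := by
  have hn0 : toReal n ≠ 0 := by
    intro h0
    have h1 := toReal_dotProduct_toReal ψ n
    rw [hψn, h0] at h1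
    simp at h1
  obtain ⟨G, C, hC, hLip, hs, hG⟩ := exists_gauge hrat (toReal ψ) hψ ⟨_, hn, hn0⟩
  -- The point `a + G a • ψ` lies in the dual cone, so its value on `n` is nonnegative.
  have hlow : ∀ a, -(a ⬝ᵥ toReal n) ≤ G a := by
    intro a
    have h1 := (hG (a + G a • toReal ψ)).1 (by rw [hs]; simp) _ hn
    rw [add_dotProduct, smul_dotProduct, toReal_dotProduct_toReal, hψn] at h1
    simp at h1
    linarith
  set W : Set (Fin d → ℤ) := {w | ∃ h : w ∈ orthogonalLattice n, ∃ a, G a < 0 ∧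
    G (a + toReal w) < 0 ∧ -1 < periodicInf n G a} with hW
  have hspan : ∀ m : Fin d → ℤ, m ⬝ᵥ n = 0 →
      ∃ N : ℕ, 0 < N ∧ N • m ∈ Submodule.span ℤ W := by
    intro m hm
    refine exists_smul_mem_span_of_toRat_mem W ?_
    by_contra hnot
    obtain ⟨f, hf, hfW⟩ := Submodule.exists_le_ker_of_notMem hnot
    let x : (Fin d → ℤ) →+ ℝ := (Rat.castHom ℝ).toAddMonoidHom.comp (f.toAddMonoidHom.comp toRat)
    obtain ⟨a, w, hxw, h1, h2, h3⟩ := exists_translates hC hlow hLip hs x ⟨m, hm⟩ (by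
      simpa [x] using hf)
    refine hxw ?_
    have : f (toRat w) = 0 := hfW (Submodule.subset_span ⟨w, ⟨w.2, a, h1, h2, h3⟩, rfl⟩)
    simp [x, this]
  have hfg : (Submodule.span ℤ W).FG := IsNoetherian.noetherian _
  -- Each translation is available only from some `l` on; finitely many of them generate the span,
  -- which makes the bound uniform.
  obtain ⟨W', hW'W, hW'⟩ := (Submodule.fg_span_iff_fg_span_finset_subset W).1 hfg
  have hev : ∀ w ∈ W', ∃ l₀ : ℕ, ∀ l, l₀ ≤ l → w ∈ minimalTranslations σ n l := by
    intro w hw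
    obtain ⟨h, a, h1, h2, h3⟩ := hW'W hw
    exact eventually_mem_minimalTranslations hψn hC hlow hLip hs hG (m := ⟨w, h⟩) h1 h2 h3
  choose! L hL using hev
  refine ⟨W'.sup L, fun l hl m hm => ?_⟩
  obtain ⟨N, hN, h⟩ := hspan m hm
  refine ⟨N, hN, ?_⟩
  rw [hW'] at h
  exact Submodule.span_mono (fun w hw => hL w hw l ((Finset.le_sup hw).trans hl)) h

/-! ### Flatness modulo nilpotents -/

section Flatness

open scoped TensorProduct

variable {R K B D Q : Type*} [CommRing R] [IsDomain R] [Field K] [Algebra R K] [IsFractionRing R K]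
  [CommRing B] [Algebra R B] [Algebra B K] [IsScalarTower R B K]
  [CommRing D] [Algebra R D] [CommRing Q] [Algebra B Q]

/-- Up to a nonzero factor from `R`, each element of `B ⊗ D` comes from `D` when `B` lies in the
fraction field of `R`. -/
theorem exists_smul_eq_one_tmul (hBK : Function.Injective (algebraMap B K)) (x : B ⊗[R] D) :
    ∃ r : R, r ≠ 0 ∧ ∃ y : D, r • x = 1 ⊗ₜ y := by
  induction x with
  | zero => exact ⟨1, one_ne_zero, 0, by simp⟩
  | tmul b y =>
    obtain ⟨p, s, hs, h⟩ := IsFractionRing.div_surjective (A := R) (algebraMap B K b)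
    have hs0 : s ≠ 0 := nonZeroDivisors.ne_zero hs
    have hsb : algebraMap R B s * b = algebraMap R B p := by
      apply hBK
      rw [map_mul, ← IsScalarTower.algebraMap_apply, ← IsScalarTower.algebraMap_apply, ← h,
        mul_div_cancel₀]
      simpa using hs0
    refine ⟨s, hs0, p • y, ?_⟩
    rw [TensorProduct.smul_tmul', Algebra.smul_def, hsb, Algebra.algebraMap_eq_smul_one,
      TensorProduct.smul_tmul]
  | add x y hx hy =>
    obtain ⟨r, hr, x', hx'⟩ := hx
    obtain ⟨s, hs, y', hy'⟩ := hy
    refine ⟨r * s, mul_ne_zero hr hs, s • x' + r • y', ?_⟩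
    rw [smul_add, TensorProduct.tmul_add, TensorProduct.tmul_smul, TensorProduct.tmul_smul,
      ← hx', ← hy', smul_smul, smul_smul, mul_comm s r]

/-- The base change of `θ` kills nilpotents: a nonzero multiple of a nilpotent element is `1 ⊗ y`
with `y` nilpotent in the domain `D`, hence zero, and `K` has no `R`-torsion. So it descends to `Q`.
-/
theorem exists_linearMap_extension [IsDomain D] (hBK : Function.Injective (algebraMap B K))
    (hRD : Function.Injective (algebraMap R D)) (π : B ⊗[R] D →ₐ[B] Q)
    (hπ : Function.Surjective π) (hker : ∀ x, π x = 0 → IsNilpotent x) (θ : D →ₗ[R] K) :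
    ∃ Θ : Q →ₗ[B] K, ∀ b y, Θ (π (b ⊗ₜ y)) = algebraMap B K b * θ y := by
  let T : B ⊗[R] D →ₗ[B] K := θ.liftBaseChange B
  -- Both `B`, through `K`, and `D` map to the fraction field of `D`, where `1 ⊗ y` becomes `y`.
  have hinj : ∀ y : D, (1 : B) ⊗ₜ[R] y = 0 → y = 0 := by
    intro y hy
    have hRL : Function.Injective (algebraMap R (FractionRing D)) := by
      rw [IsScalarTower.algebraMap_eq R D]
      exact (IsFractionRing.injective D _).comp hRD
    let f : K →ₐ[R] FractionRing D := IsFractionRing.liftAlgHom (g := Algebra.ofId R _) hRL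
    let g : B ⊗[R] D →ₐ[R] FractionRing D :=
      Algebra.TensorProduct.lift (f.comp (IsScalarTower.toAlgHom R B K))
        (IsScalarTower.toAlgHom R D _) (fun _ _ => mul_comm _ _)
    have h : g (1 ⊗ₜ y) = algebraMap D (FractionRing D) y := by
      refine (Algebra.TensorProduct.lift_tmul _ _ _ _ _).trans ?_
      simp
    rw [hy, map_zero] at h
    exact IsFractionRing.injective D (FractionRing D) (by rw [← h, map_zero])
  have hT : LinearMap.ker π.toLinearMap ≤ LinearMap.ker T := by
    intro x hx
    obtain ⟨N, hN⟩ := hker x hx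
    obtain ⟨r, hr, y, hy⟩ := exists_smul_eq_one_tmul hBK x
    have hy0 : y = 0 := by
      have h1 : (1 : B) ⊗ₜ[R] (y ^ N) = 0 := by
        have := congrArg (· ^ N) hy
        simp only [smul_pow, hN, smul_zero, Algebra.TensorProduct.tmul_pow, one_pow] at this
        exact this.symm
      exact by_contra fun h0 => pow_ne_zero N h0 (hinj _ h1)
    rw [LinearMap.mem_ker]
    have h2 : T (algebraMap R B r • x) = 0 := by
      rw [algebraMap_smul, hy, hy0, TensorProduct.tmul_zero, map_zero]
    rw [map_smul, Algebra.smul_def, ← IsScalarTower.algebraMap_apply] at h2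
    refine (mul_eq_zero.1 h2).resolve_left ?_
    simpa using hr
  have hπ' : Function.Surjective π.toLinearMap := hπ
  have hex : ∃ Θ : Q →ₗ[B] K, Θ ∘ₗ π.toLinearMap = T := by
    refine ⟨(LinearMap.ker π.toLinearMap).liftQ T hT ∘ₗ
      (π.toLinearMap.quotKerEquivOfSurjective hπ').symm.toLinearMap, ?_⟩
    refine LinearMap.ext fun x => ?_
    have : (π.toLinearMap.quotKerEquivOfSurjective hπ').symm (π.toLinearMap x) =
        Submodule.Quotient.mk x := by
      rw [LinearEquiv.symm_apply_eq, LinearMap.quotKerEquivOfSurjective_apply_mk]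
    simp only [LinearMap.comp_apply, LinearEquiv.coe_coe, this, Submodule.liftQ_apply]
  obtain ⟨Θ, hΘ⟩ := hex
  refine ⟨Θ, fun b y => ?_⟩
  have := LinearMap.congr_fun hΘ (b ⊗ₜ y)
  simpa [T, Algebra.smul_def] using this

/-- By the equational criterion, the relation `b q' - b' q = 0` comes from relations in `B`, with `q
= ∑ a₁ⱼ yⱼ`. Applying `Θ` gives `1 = ∑ a₁ⱼ Θ yⱼ` in `O`, so some `a₁ⱼ` is a unit of `O`. -/
theorem exists_ratio_of_flat {O : ValuationSubring K} [Module.Flat B Q]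
    (hBO : ∀ b : B, algebraMap B K b ∈ O) (Θ : Q →ₗ[B] K) (hΘ : ∀ y, Θ y ∈ O) {q q' : Q}
    (hq : Θ q = 1) {b b' : B} (h : b • q' = b' • q) :
    ∃ b₁ b₂ : B, O.valuation (algebraMap B K b₂) = 1 ∧ b * b₁ = b' * b₂ := by
  have hrel : ∑ i : Fin 2, (![b, -b'] i) • (![q', q] i) = 0 := by
    simp [Fin.sum_univ_two, h]
  obtain ⟨κ, a, y, hay, hfa⟩ :=
    Module.Flat.isTrivialRelation_of_sum_smul_eq_zero (R := B) (M := Q) (f := ![b, -b'])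
      (x := ![q', q]) hrel
  have hex : ∃ j : Fin κ, ¬ O.valuation (algebraMap B K (a 1 j)) < 1 := by
    by_contra! hall
    have h1 : (1 : K) = ∑ j, algebraMap B K (a 1 j) * Θ (y j) := by
      have h2 := hay 1
      simp only [Matrix.cons_val_one] at h2
      rw [← hq, show q = _ from h2, map_sum]
      exact Finset.sum_congr rfl fun j _ => by rw [map_smul, Algebra.smul_def]
    have h2 : O.valuation (∑ j, algebraMap B K (a 1 j) * Θ (y j)) < 1 := by
      refine O.valuation.map_sum_lt one_ne_zero fun j _ => ?_
      rw [map_mul]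
      exact mul_lt_one_of_lt_of_le (hall j) ((O.valuation_le_one_iff _).2 (hΘ _))
    rw [← h1, map_one] at h2
    exact lt_irrefl _ h2
  obtain ⟨j, hj⟩ := hex
  refine ⟨a 0 j, a 1 j, le_antisymm ((O.valuation_le_one_iff _).2 (hBO _)) (not_lt.1 hj), ?_⟩
  have := hfa j
  simp [Fin.sum_univ_two] at this
  linear_combination this

end Flatness

/-! ### Monomials in the function field -/

theorem exists_add_nsmul_mem {d : ℕ} {σ : PointedCone ℝ (Fin d → ℝ)} (hrat : IsRationalPolyhedral σ)
    {ψ : Fin d → ℤ} (hψ : ∀ x ∈ σ, x ≠ 0 → 0 < toReal ψ ⬝ᵥ x) (m : Fin d → ℤ) :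
    ∃ N : ℕ, m + N • ψ ∈ dualMonoid σ := by
  by_cases hne : ∃ x ∈ σ, x ≠ 0
  · obtain ⟨G, C, -, -, hs, hG⟩ := exists_gauge hrat (toReal ψ) hψ hne
    obtain ⟨N, hN⟩ := exists_nat_ge (G (toReal m))
    refine ⟨N, ?_⟩
    rw [mem_dualMonoid, ← hG, toReal_add, toReal_nsmul, hs]
    linarith
  · push Not at hne
    refine ⟨0, fun x hx => ?_⟩
    rw [hne x hx]
    simp [pairing]

/-- The monomials of `k[M]`, as elements of the function field of `X_σ`. -/
theorem exists_character (k : Type u) [Field k] {d : ℕ} {σ : PointedCone ℝ (Fin d → ℝ)}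
    (h : ∀ m : Fin d → ℤ, ∃ a ∈ dualMonoid σ, m + a ∈ dualMonoid σ) :
    ∃ χ : (Fin d → ℤ) → functionField k σ, (∀ m m', χ (m + m') = χ m * χ m') ∧
      ∀ a : dualMonoid σ, χ a = algebraMap (coordRing k σ) _ (AddMonoidAlgebra.single a 1) := by
  choose a ha hma using h
  let X : dualMonoid σ → functionField k σ := fun a =>
    algebraMap (coordRing k σ) _ (AddMonoidAlgebra.single a 1)
  have hX0 : ∀ a, X a ≠ 0 := by
    intro a
    simp only [X, ne_eq, FaithfulSMul.algebraMap_eq_zero_iff]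
    rw [AddMonoidAlgebra.single_eq_zero]
    exact one_ne_zero
  have hXadd : ∀ a b, X (a + b) = X a * X b := by
    intro a b
    simp only [X, ← map_mul, AddMonoidAlgebra.single_mul_single, one_mul]
  -- Every `m` is a difference of two elements of `A`; the quotient of their monomials depends on
  -- `m` alone.
  have hwell : ∀ (p q r s : dualMonoid σ), (p : Fin d → ℤ) - q = (r : Fin d → ℤ) - s →
      X p / X q = X r / X s := by
    intro p q r s h
    rw [div_eq_div_iff (hX0 _) (hX0 _), ← hXadd, ← hXadd]
    congr 1
    ext1
    push_cast
    rw [sub_eq_sub_iff_add_eq_add] at h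
    exact h
  refine ⟨fun m => X ⟨m + a m, hma m⟩ / X ⟨a m, ha m⟩, ?_, ?_⟩
  · intro m m'
    rw [div_mul_div_comm, ← hXadd, ← hXadd]
    refine hwell _ _ _ _ ?_
    push_cast
    abel
  · intro p
    rw [show algebraMap (coordRing k σ) (functionField k σ) (AddMonoidAlgebra.single p 1)
      = X p / X 0 by
        have : X 0 = 1 := by
          simp only [X]
          exact map_one (algebraMap (coordRing k σ) _)
        rw [this, div_one]]
    refine hwell _ _ _ _ ?_
    push_cast
    abel

/-! ### Graded components and the flatness relation -/

section Component

open scoped TensorProduct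

variable {k : Type u} [Field k] {d : ℕ} {σ : PointedCone ℝ (Fin d → ℝ)}

theorem coordRing_induction {τ : PointedCone ℝ (Fin d → ℝ)} {p : coordRing k τ → Prop}
    (h0 : p 0) (hadd : ∀ f g, p f → p g → p (f + g))
    (hsingle : ∀ m c, p (AddMonoidAlgebra.single m c)) (f : coordRing k τ) : p f := by
  induction f using AddMonoidAlgebra.induction_linear with
  | zero => exact h0
  | add f g hf hg => exact hadd f g hf hg
  | single m c => exact hsingle m c

open Classical in
/-- The component of an element of `k[(1/l)A]` in the class of `a / l` modulo `M`, divided by the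
monomial of `a / l`. -/
def componentMap (χ : (Fin d → ℤ) → functionField k σ) (a : Fin d → ℤ) (l : ℕ) :
    coordRing k σ →+ functionField k σ :=
  ((Finsupp.linearCombination k fun e : dualMonoid σ =>
      if h : ∃ v : Fin d → ℤ, (e : Fin d → ℤ) = a + l • v then χ h.choose else 0).toAddMonoidHom).comp
    (AddMonoidAlgebra.coeffAddEquiv (R := k) (M := dualMonoid σ)).toAddMonoidHom

/-- For `0 < l` the vector `v` is unique, so the choice in `componentMap` is harmless. -/
theorem componentMap_single_of_eq (χ : (Fin d → ℤ) → functionField k σ) {a : Fin d → ℤ} {l : ℕ}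
    (hl : 0 < l) {e : dualMonoid σ} {v : Fin d → ℤ} (he : (e : Fin d → ℤ) = a + l • v) (c : k) :
    componentMap χ a l (AddMonoidAlgebra.single e c) = c • χ v := by
  have h : ∃ v : Fin d → ℤ, (e : Fin d → ℤ) = a + l • v := ⟨v, he⟩
  have hv : h.choose = v := by
    have h1 := h.choose_spec
    have h2 : l • v = l • h.choose := add_left_cancel (he.symm.trans h1)
    ext i
    have h3 := congrFun h2 i
    simp only [Pi.smul_apply, nsmul_eq_mul] at h3
    exact (mul_left_cancel₀ (by exact_mod_cast hl.ne') h3).symm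
  simp only [componentMap, AddMonoidHom.comp_apply]
  change Finsupp.linearCombination k _ (Finsupp.single e c) = _
  rw [Finsupp.linearCombination_single, dif_pos h, hv]

theorem componentMap_single_of_forall_ne (χ : (Fin d → ℤ) → functionField k σ) {a : Fin d → ℤ}
    {l : ℕ} {e : dualMonoid σ} (he : ¬ ∃ v : Fin d → ℤ, (e : Fin d → ℤ) = a + l • v) (c : k) :
    componentMap χ a l (AddMonoidAlgebra.single e c) = 0 := by
  simp only [componentMap, AddMonoidHom.comp_apply]
  change Finsupp.linearCombination k _ (Finsupp.single e c) = _
  rw [Finsupp.linearCombination_single, dif_neg he, smul_zero]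

theorem algebraMap_single {χ : (Fin d → ℤ) → functionField k σ}
    (hχ : ∀ a : dualMonoid σ, χ a = algebraMap (coordRing k σ) _ (AddMonoidAlgebra.single a 1))
    (a : dualMonoid σ) (c : k) :
    algebraMap (coordRing k σ) (functionField k σ) (AddMonoidAlgebra.single a c) = c • χ a := by
  rw [hχ, Algebra.smul_def, IsScalarTower.algebraMap_apply k (coordRing k σ), ← map_mul]
  congr 1
  rw [← Algebra.smul_def, AddMonoidAlgebra.smul_single, smul_eq_mul, mul_one]

/-- Multiplication by `k[A]` preserves the classes modulo `M`; this is the linearity over `k[A]`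
needed to extend the component map to the pullback. -/
theorem componentMap_mul {χ : (Fin d → ℤ) → functionField k σ}
    (hadd : ∀ m m', χ (m + m') = χ m * χ m')
    (hχ : ∀ a : dualMonoid σ, χ a = algebraMap (coordRing k σ) _ (AddMonoidAlgebra.single a 1))
    (a : Fin d → ℤ) {l : ℕ} (hl : 0 < l) (r f : coordRing k σ) :
    componentMap χ a l (AddMonoidAlgebra.mapDomainRingHom k
      (nsmulAddMonoidHom (α := dualMonoid σ) l) r * f) =
      algebraMap _ _ r * componentMap χ a l f := by
  induction r using coordRing_induction with
  | h0 => simp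
  | hadd r s hr hs => rw [map_add, add_mul, map_add, hr, hs, map_add, add_mul]
  | hsingle m c =>
    induction f using coordRing_induction with
    | h0 => simp
    | hadd r s hr hs => rw [mul_add, map_add, hr, hs, map_add, mul_add]
    | hsingle e c' =>
      have h1 : AddMonoidAlgebra.mapDomainRingHom k (nsmulAddMonoidHom (α := dualMonoid σ) l)
          (AddMonoidAlgebra.single m c) * AddMonoidAlgebra.single e c' =
          AddMonoidAlgebra.single (l • m + e) (c * c') := by
        rw [AddMonoidAlgebra.mapDomainRingHom_apply, AddMonoidAlgebra.mapDomain_single,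
          AddMonoidAlgebra.single_mul_single]
        rfl
      rw [h1, algebraMap_single hχ]
      by_cases he : ∃ v : Fin d → ℤ, (e : Fin d → ℤ) = a + l • v
      · obtain ⟨v, hv⟩ := he
        rw [componentMap_single_of_eq χ hl hv, componentMap_single_of_eq χ hl
          (show ((l • m + e : dualMonoid σ) : Fin d → ℤ) = a + l • ((m : Fin d → ℤ) + v) by
            push_cast
            rw [hv, smul_add]
            abel), hadd, smul_mul_smul_comm]
      · rw [componentMap_single_of_forall_ne χ he, componentMap_single_of_forall_ne, mul_zero]
        rintro ⟨v, hv⟩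
        refine he ⟨v - m, ?_⟩
        push_cast at hv
        rw [smul_sub, eq_sub_of_add_eq' hv]
        abel

theorem componentMap_mem {χ : (Fin d → ℤ) → functionField k σ} {a : Fin d → ℤ} {l : ℕ}
    (hl : 0 < l) {O : ValuationSubring (functionField k σ)}
    (hk : ∀ c : k, algebraMap k (functionField k σ) c ∈ O)
    (hO : ∀ v : Fin d → ℤ, a + l • v ∈ dualMonoid σ → χ v ∈ O) (f : coordRing k σ) :
    componentMap χ a l f ∈ O := by
  induction f using coordRing_induction with
  | h0 => rw [map_zero]; exact zero_mem _
  | hadd f g hf hg => rw [map_add]; exact add_mem hf hg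
  | hsingle e c =>
    by_cases he : ∃ v : Fin d → ℤ, (e : Fin d → ℤ) = a + l • v
    · obtain ⟨v, hv⟩ := he
      rw [componentMap_single_of_eq χ hl hv, Algebra.smul_def]
      exact mul_mem (hk c) (hO v (hv ▸ e.2))
    · rw [componentMap_single_of_forall_ne χ he]
      exact zero_mem _

/-- If the pullback of `k[A] → k[(1/l)A]` to an overring `B` of `k[A]` in the function field is
flat modulo nilpotents, and `B` lies in a valuation ring `O`, then the monomials of
`minimalTranslations` are quotients of elements of `B` with denominators that are units of `O`. -/
theorem exists_ratio_of_isPushout {χ : (Fin d → ℤ) → functionField k σ}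
    (hadd : ∀ m m', χ (m + m') = χ m * χ m')
    (hχ : ∀ a : dualMonoid σ, χ a = algebraMap (coordRing k σ) _ (AddMonoidAlgebra.single a 1))
    (hA : ∀ m : Fin d → ℤ, ∃ a ∈ dualMonoid σ, m + a ∈ dualMonoid σ)
    {O : ValuationSubring (functionField k σ)} {n : Fin d → ℤ}
    (hO : ∀ m : Fin d → ℤ, 0 ≤ m ⬝ᵥ n → χ m ∈ O) {l : ℕ} (hl : 0 < l)
    {B D E Q : CommRingCat.{u}} (β : CommRingCat.of (coordRing k σ) ⟶ B)
    (F : CommRingCat.of (coordRing k σ) ⟶ D) (e : CommRingCat.of (coordRing k σ) ≅ D)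
    (hF : F = CommRingCat.ofHom (AddMonoidAlgebra.mapDomainRingHom k
      (nsmulAddMonoidHom (α := dualMonoid σ) l)) ≫ e.hom)
    (inl : B ⟶ E) (inr : D ⟶ E) (hp : IsPushout β F inl inr) (ρ : E ⟶ Q)
    (hρ : Function.Surjective ρ.hom) (hker : ∀ x, ρ.hom x = 0 → IsNilpotent x)
    (hflat : (inl ≫ ρ).hom.Flat) (ι : B →+* functionField k σ) (hι : Function.Injective ι)
    (hιβ : ι.comp β.hom = algebraMap (coordRing k σ) (functionField k σ))
    (hBO : ∀ b, ι b ∈ O) {w : Fin d → ℤ} (hw : w ∈ minimalTranslations σ n l) :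
    ∃ b₁ b₂ : B, O.valuation (ι b₂) = 1 ∧ ι b₁ = χ w * ι b₂ := by
  obtain ⟨-, a, ha, haw, hmin⟩ := hw
  obtain ⟨p', hp', hwp'⟩ := hA w
  let : Algebra (coordRing k σ) B := β.hom.toAlgebra
  let : Algebra (coordRing k σ) D := F.hom.toAlgebra
  let : Algebra B Q := (inl ≫ ρ).hom.toAlgebra
  let : Algebra B (functionField k σ) := ι.toAlgebra
  have : IsScalarTower (coordRing k σ) B (functionField k σ) := .of_algebraMap_eq' hιβ.symm
  have : Module.Flat B Q := hflat
  have : IsDomain D := e.symm.commRingCatIsoToRingEquiv.toMulEquiv.isDomain (coordRing k σ)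
  have hFinj : Function.Injective F.hom := by
    rw [hF, CommRingCat.hom_comp]
    refine (e.commRingCatIsoToRingEquiv.injective).comp ?_
    refine AddMonoidAlgebra.mapDomain_injective ?_
    intro x y hxy
    have hxy' : l • x = l • y := hxy
    ext i
    have h4 : l • (x : Fin d → ℤ) = l • (y : Fin d → ℤ) := congrArg Subtype.val hxy'
    have h3 := congrFun h4 i
    simp only [Pi.smul_apply, nsmul_eq_mul] at h3
    exact mul_left_cancel₀ (by exact_mod_cast hl.ne') h3
  let θ : D →ₗ[coordRing k σ] functionField k σ :=
    { toFun := fun y => componentMap χ a l (e.inv.hom y)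
      map_add' := fun x y => by rw [map_add, map_add]
      map_smul' := fun r y => by
        have h1 : e.inv.hom (r • y) = AddMonoidAlgebra.mapDomainRingHom k
            (nsmulAddMonoidHom (α := dualMonoid σ) l) r * e.inv.hom y := by
          rw [Algebra.smul_def, map_mul]
          congr 1
          change (F ≫ e.inv).hom r = _
          rw [hF, Category.assoc, e.hom_inv_id, Category.comp_id]
          rfl
        rw [h1, componentMap_mul hadd hχ a hl, RingHom.id_apply, Algebra.smul_def] }
  let i : CommRingCat.of (B ⊗[coordRing k σ] D) ≅ E :=
    (CommRingCat.isPushout_tensorProduct (coordRing k σ) B D).isoIsPushout _ _ hp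
  have hi1 : ∀ b, i.hom.hom (b ⊗ₜ 1) = inl.hom b := by
    intro b
    have := (CommRingCat.isPushout_tensorProduct (coordRing k σ) B D).inl_isoIsPushout_hom _ _ hp
    exact congr($(this).hom b)
  have hi2 : ∀ y, i.hom.hom (1 ⊗ₜ y) = inr.hom y := by
    intro y
    have := (CommRingCat.isPushout_tensorProduct (coordRing k σ) B D).inr_isoIsPushout_hom _ _ hp
    exact congr($(this).hom y)
  let π : B ⊗[coordRing k σ] D →ₐ[B] Q :=
    { toRingHom := (i.hom ≫ ρ).hom
      commutes' := fun b => congrArg ρ.hom (hi1 b) }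
  have hi : Function.Bijective i.hom.hom := i.commRingCatIsoToRingEquiv.bijective
  have hπ : Function.Surjective π := hρ.comp hi.2
  have hπker : ∀ x, π x = 0 → IsNilpotent x := by
    intro x hx
    exact (IsNilpotent.map_iff hi.1).1 (hker _ hx)
  obtain ⟨Θ, hΘ⟩ := exists_linearMap_extension (R := coordRing k σ) (K := functionField k σ)
    (B := B) (D := D) (Q := Q) hι hFinj π hπ hπker θ
  have hkO : ∀ c : k, algebraMap k (functionField k σ) c ∈ O := by
    intro c
    rw [IsScalarTower.algebraMap_apply k (coordRing k σ), ← hιβ]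
    exact hBO _
  -- Here minimality enters: every exponent in the class of `a / l` exceeds `a / l` by some `v` with
  -- `0 ≤ v ⬝ᵥ n`, and then `χ v ∈ O`.
  have hΘO : ∀ y, Θ y ∈ O := by
    intro y
    obtain ⟨x, rfl⟩ := hπ y
    induction x with
    | zero => rw [map_zero, map_zero]; exact zero_mem _
    | add x y hx hy => rw [map_add, map_add]; exact add_mem hx hy
    | tmul b y =>
      rw [hΘ]
      exact mul_mem (hBO b) (componentMap_mem hl hkO (fun v hv => hO v (hmin v hv)) _)
  let q : dualMonoid σ → Q := fun m => π (1 ⊗ₜ e.hom.hom (AddMonoidAlgebra.single m 1))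
  have hχ0 : χ 0 = 1 := by
    have := hχ 0
    rw [AddSubmonoid.coe_zero] at this
    rw [this]
    exact map_one (algebraMap (coordRing k σ) _)
  have hq : Θ (q ⟨a, ha⟩) = 1 := by
    simp only [q]
    rw [hΘ, map_one, one_mul]
    change componentMap χ a l ((e.hom ≫ e.inv).hom _) = 1
    rw [e.hom_inv_id]
    change componentMap χ a l (AddMonoidAlgebra.single _ 1) = 1
    rw [componentMap_single_of_eq χ hl (v := 0) (by simp), hχ0, one_smul]
  have hsmul : ∀ m m' : dualMonoid σ, β.hom (AddMonoidAlgebra.single m 1) • q m' =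
      q (l • m + m') := by
    intro m m'
    simp only [q]
    have h1 : (AddMonoidAlgebra.single (l • m + m') 1 : coordRing k σ) =
        AddMonoidAlgebra.mapDomainRingHom k (nsmulAddMonoidHom (α := dualMonoid σ) l)
          (AddMonoidAlgebra.single m 1) * AddMonoidAlgebra.single m' 1 := by
      rw [AddMonoidAlgebra.mapDomainRingHom_apply, AddMonoidAlgebra.mapDomain_single,
        AddMonoidAlgebra.single_mul_single, mul_one]
      rfl
    have h2 : e.hom.hom (AddMonoidAlgebra.mapDomainRingHom k
        (nsmulAddMonoidHom (α := dualMonoid σ) l) (AddMonoidAlgebra.single m 1)) =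
        algebraMap (coordRing k σ) D (AddMonoidAlgebra.single m 1) := by
      change _ = F.hom _
      rw [hF]
      rfl
    rw [h1, map_mul, h2, ← map_smul, TensorProduct.smul_tmul', ← Algebra.smul_def,
      ← TensorProduct.smul_tmul, smul_eq_mul, mul_one, Algebra.smul_def, mul_one]
    rfl
  -- Since `w` itself need not lie in `A`, it is written as a difference of `w + p'` and `p'`, both
  -- in `A`.
  have hrel : β.hom (AddMonoidAlgebra.single ⟨p', hp'⟩ 1) • q ⟨a + l • w, haw⟩ =
      β.hom (AddMonoidAlgebra.single ⟨w + p', hwp'⟩ 1) • q ⟨a, ha⟩ := by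
    rw [hsmul, hsmul]
    congr 1
    ext1
    push_cast
    rw [smul_add]
    abel
  obtain ⟨b₁, b₂, hb₂, hb⟩ := exists_ratio_of_flat (K := functionField k σ) hBO Θ hΘO hq hrel
  refine ⟨b₁, b₂, hb₂, ?_⟩
  have hβ : ∀ m : dualMonoid σ, ι (β.hom (AddMonoidAlgebra.single m 1)) = χ m := by
    intro m
    rw [hχ, ← hιβ]
    rfl
  have h1 := congrArg ι hb
  rw [map_mul, map_mul, hβ, hβ, hadd] at h1
  have h2 : χ p' ≠ 0 := by
    have := hχ ⟨p', hp'⟩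
    rw [this, ne_eq, FaithfulSMul.algebraMap_eq_zero_iff, AddMonoidAlgebra.single_eq_zero]
    exact one_ne_zero
  refine mul_left_cancel₀ h2 ?_
  simp only at h1
  rw [h1]
  ring

end Component

/-! ### Local rings of normalizations -/

/-- The localization of a subring of a valuation ring at the center of the valuation. -/
def localizationAtCenter {K : Type*} [Field K] (O : ValuationSubring K) (S : Subring K) :
    Subring K where
  carrier := {t | ∃ s ∈ S, O.valuation s = 1 ∧ t * s ∈ S}
  zero_mem' := ⟨1, one_mem _, map_one _, by simp⟩
  one_mem' := ⟨1, one_mem _, map_one _, by simp⟩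
  add_mem' := by
    rintro a b ⟨s, hs, hs1, has⟩ ⟨t, ht, ht1, hbt⟩
    refine ⟨s * t, mul_mem hs ht, by rw [map_mul, hs1, ht1, one_mul], ?_⟩
    rw [show (a + b) * (s * t) = a * s * t + b * t * s by ring]
    exact add_mem (mul_mem has ht) (mul_mem hbt hs)
  mul_mem' := by
    rintro a b ⟨s, hs, hs1, has⟩ ⟨t, ht, ht1, hbt⟩
    refine ⟨s * t, mul_mem hs ht, by rw [map_mul, hs1, ht1, one_mul], ?_⟩
    rw [show a * b * (s * t) = a * s * (b * t) by ring]
    exact mul_mem has hbt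
  neg_mem' := by
    rintro a ⟨s, hs, hs1, has⟩
    exact ⟨s, hs, hs1, by rw [neg_mul]; exact neg_mem has⟩

section LocalizationAtCenter

variable {K : Type*} [Field K] {O : ValuationSubring K} {S : Subring K}

theorem le_localizationAtCenter : S ≤ localizationAtCenter O S :=
  fun t ht => ⟨1, one_mem _, map_one _, by simpa⟩

theorem mem_localizationAtCenter_of_mul_mem {t s : K} (hs : s ∈ localizationAtCenter O S)
    (hs1 : O.valuation s = 1) (hts : t * s ∈ localizationAtCenter O S) :
    t ∈ localizationAtCenter O S := by
  obtain ⟨p, hp, hp1, hsp⟩ := hs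
  obtain ⟨q, hq, hq1, htq⟩ := hts
  refine ⟨s * p * q, mul_mem hsp hq, by rw [map_mul, map_mul, hs1, hp1, hq1]; simp, ?_⟩
  rw [show t * (s * p * q) = t * s * q * p by ring]
  exact mul_mem htq hp

/-- If `t ^ N * s ∈ S`, then `(t * s) ^ N ∈ S`, so `t * s` lies in `T`. This is where normality
enters. -/
theorem mem_localizationAtCenter_of_pow_mem {T : Subring K} (hST : S ≤ T)
    (hint : ∀ t : K, ∀ N : ℕ, 0 < N → t ^ N ∈ S → t ∈ T) {t : K} {N : ℕ} (hN : 0 < N)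
    (ht : t ^ N ∈ localizationAtCenter O S) : t ∈ localizationAtCenter O T := by
  obtain ⟨s, hs, hs1, hts⟩ := ht
  refine ⟨s, hST hs, hs1, hint _ N hN ?_⟩
  obtain ⟨N, rfl⟩ := Nat.exists_eq_succ_of_ne_zero hN.ne'
  rw [mul_pow, pow_succ s, show t ^ (N + 1) * (s ^ N * s) = t ^ (N + 1) * s * s ^ N by ring]
  exact mul_mem hts (pow_mem hs N)

end LocalizationAtCenter

/-! ### Monomials in the local ring at the center -/

section Toric

variable {k : Type u} [Field k] {d : ℕ} {σ : PointedCone ℝ (Fin d → ℝ)}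
  {χ : (Fin d → ℤ) → functionField k σ}

theorem character_ne_zero (hadd : ∀ m m', χ (m + m') = χ m * χ m')
    (hχ : ∀ a : dualMonoid σ, χ a = algebraMap (coordRing k σ) _ (AddMonoidAlgebra.single a 1)) :
    χ 0 = 1 ∧ ∀ m, χ m ≠ 0 := by
  have hχ0 : χ 0 = 1 := by
    have := hχ 0
    rw [AddSubmonoid.coe_zero] at this
    rw [this]
    exact map_one (algebraMap (coordRing k σ) _)
  refine ⟨hχ0, fun m hm => ?_⟩
  have := hadd m (-m)
  rw [hm, add_neg_cancel, hχ0, zero_mul] at this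
  exact one_ne_zero this

theorem character_nsmul (hadd : ∀ m m', χ (m + m') = χ m * χ m') (hχ0 : χ 0 = 1)
    (N : ℕ) (m : Fin d → ℤ) : χ (N • m) = χ m ^ N := by
  induction N with
  | zero => simp [hχ0]
  | succ N ih => rw [succ_nsmul, hadd, ih, pow_succ]

/-- The monomials orthogonal to `n` are units of `O`, so those in the localization of `S` form a
group, which contains the span of `W`. Extracting roots in `T` gives all of `n^⊥`, and `ψ` supplies
the complementary direction because `ψ ⬝ᵥ n = 1`. -/
theorem character_mem_localizationAtCenter (hadd : ∀ m m', χ (m + m') = χ m * χ m')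
    (hχ : ∀ a : dualMonoid σ, χ a = algebraMap (coordRing k σ) _ (AddMonoidAlgebra.single a 1))
    {O : ValuationSubring (functionField k σ)} {n ψ : Fin d → ℤ} (hψn : ψ ⬝ᵥ n = 1)
    (hψ : ψ ∈ dualMonoid σ) (hO : ∀ m : Fin d → ℤ, 0 ≤ m ⬝ᵥ n → χ m ∈ O)
    {W : Set (Fin d → ℤ)} (hWn : ∀ w ∈ W, w ⬝ᵥ n = 0)
    (hW : ∀ m : Fin d → ℤ, m ⬝ᵥ n = 0 → ∃ N : ℕ, 0 < N ∧ N • m ∈ Submodule.span ℤ W)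
    {S T : Subring (functionField k σ)} (hS : ∀ f, algebraMap (coordRing k σ) _ f ∈ S)
    (hST : S ≤ T) (hint : ∀ t : functionField k σ, ∀ N : ℕ, 0 < N → t ^ N ∈ S → t ∈ T)
    (hWS : ∀ w ∈ W, χ w ∈ localizationAtCenter O S) {m : Fin d → ℤ} (hm : 0 ≤ m ⬝ᵥ n) :
    χ m ∈ localizationAtCenter O T := by
  obtain ⟨hχ0, hχne⟩ := character_ne_zero hadd hχ
  have hunit : ∀ m : Fin d → ℤ, m ⬝ᵥ n = 0 → O.valuation (χ m) = 1 := by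
    intro m hm
    have h1 := (O.valuation_le_one_iff _).2 (hO m hm.ge)
    have h2 := (O.valuation_le_one_iff _).2 (hO (-m) (by rw [neg_dotProduct, hm, neg_zero]))
    have h3 : O.valuation (χ m) * O.valuation (χ (-m)) = 1 := by
      rw [← map_mul, ← hadd, add_neg_cancel, hχ0, map_one]
    refine le_antisymm h1 ?_
    rw [← h3]
    exact mul_le_of_le_one_right' h2
  let P : AddSubgroup (Fin d → ℤ) :=
    { carrier := {m | m ⬝ᵥ n = 0 ∧ χ m ∈ localizationAtCenter O S}
      zero_mem' := ⟨by simp, by rw [hχ0]; exact one_mem _⟩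
      add_mem' := by
        rintro a b ⟨ha, ha'⟩ ⟨hb, hb'⟩
        exact ⟨by rw [add_dotProduct, ha, hb, add_zero], by rw [hadd]; exact mul_mem ha' hb'⟩
      neg_mem' := by
        rintro a ⟨ha, ha'⟩
        refine ⟨by rw [neg_dotProduct, ha, neg_zero],
          mem_localizationAtCenter_of_mul_mem ha' (hunit a ha) ?_⟩
        rw [← hadd, neg_add_cancel, hχ0]
        exact one_mem _ }
  have hP : Submodule.span ℤ W ≤ P.toIntSubmodule :=
    Submodule.span_le.2 fun w hw => ⟨hWn w hw, hWS w hw⟩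
  have horth : ∀ m : Fin d → ℤ, m ⬝ᵥ n = 0 → χ m ∈ localizationAtCenter O T := by
    intro m hm
    obtain ⟨N, hN, hNm⟩ := hW m hm
    refine mem_localizationAtCenter_of_pow_mem hST hint hN ?_
    rw [← character_nsmul hadd hχ0]
    exact (hP hNm).2
  obtain ⟨j, hj⟩ := Int.eq_ofNat_of_zero_le hm
  have hdecomp : m = (m - j • ψ) + j • ψ := by abel
  rw [hdecomp, hadd, character_nsmul hadd hχ0]
  refine mul_mem (horth _ ?_) (pow_mem (le_localizationAtCenter (hST ?_)) j)
  · rw [sub_dotProduct, smul_dotProduct, hψn, hj]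
    simp
  · have := hχ ⟨ψ, hψ⟩
    rw [this]
    exact hS _

/-- A valuation ring that is the localization of `k[τ^∨ ∩ M]` at a prime is contained in each
localization that contains the monomials of `τ^∨ ∩ M`. -/
theorem mem_localizationAtCenter_of_chart {O : ValuationSubring (functionField k σ)}
    {τ : PointedCone ℝ (Fin d → ℝ)} (φ : coordRing k τ →+* functionField k σ)
    (hφ : ∀ m c, φ (AddMonoidAlgebra.single m c) = c • χ m)
    (hfrac : ∀ o ∈ O, ∃ f s, O.valuation (φ s) = 1 ∧ o * φ s = φ f)
    {S : Subring (functionField k σ)} (hS : ∀ f, algebraMap (coordRing k σ) _ f ∈ S)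
    (hχS : ∀ m ∈ dualMonoid τ, χ m ∈ localizationAtCenter O S) {o : functionField k σ}
    (ho : o ∈ O) : o ∈ localizationAtCenter O S := by
  have hmem : ∀ f, φ f ∈ localizationAtCenter O S := by
    intro f
    induction f using coordRing_induction with
    | h0 => rw [map_zero]; exact zero_mem _
    | hadd f g hf hg => rw [map_add]; exact add_mem hf hg
    | hsingle m c =>
      rw [hφ, Algebra.smul_def, IsScalarTower.algebraMap_apply k (coordRing k σ)]
      exact mul_mem (le_localizationAtCenter (hS _)) (hχS m m.2)
  obtain ⟨f, s, hs, hof⟩ := hfrac o ho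
  exact mem_localizationAtCenter_of_mul_mem (hmem s) hs (hof ▸ hmem f)

end Toric

/-! ### Local rings at images of closed points -/

section LocalRing

variable {R O : Type*} [CommRing R] [CommRing O] [IsLocalRing O] (φ : R →+* O)

/-- The localization of `O` at its maximal ideal is `O` again, so surjectivity on local rings says
that each element of `O` is a fraction from `R` with unit denominator. The next lemma is the
converse, for injective `φ`. -/
theorem exists_fraction_of_surjective_localRingHom
    (h : Function.Surjective (Localization.localRingHom
      ((IsLocalRing.maximalIdeal O).comap φ) (IsLocalRing.maximalIdeal O) φ rfl)) (o : O) :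
    ∃ f s : R, IsUnit (φ s) ∧ o * φ s = φ f := by
  obtain ⟨z, hz⟩ := h (algebraMap O _ o)
  obtain ⟨f, s, rfl⟩ := IsLocalization.exists_mk'_eq
    ((IsLocalRing.maximalIdeal O).comap φ).primeCompl z
  have hs : IsUnit (φ s) := by
    have := s.2
    by_contra h
    exact this ((IsLocalRing.mem_maximalIdeal _).2 h)
  refine ⟨f, s, hs, ?_⟩
  rw [Localization.localRingHom_mk', eq_comm, IsLocalization.eq_mk'_iff_mul_eq, ← map_mul,
    IsLocalization.eq_iff_exists (IsLocalRing.maximalIdeal O).primeCompl] at hz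
  obtain ⟨c, hc⟩ := hz
  have hcu : IsUnit (c : O) := by
    by_contra h
    exact c.2 ((IsLocalRing.mem_maximalIdeal _).2 h)
  exact hcu.mul_left_cancel hc

theorem bijective_localRingHom (hinj : Function.Injective φ)
    (h : ∀ o, ∃ f s : R, IsUnit (φ s) ∧ o * φ s = φ f) :
    Function.Bijective (Localization.localRingHom
      ((IsLocalRing.maximalIdeal O).comap φ) (IsLocalRing.maximalIdeal O) φ rfl) := by
  have hunit : ∀ c : (IsLocalRing.maximalIdeal O).primeCompl, IsUnit (c : O) := by
    intro c
    by_contra h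
    exact c.2 ((IsLocalRing.mem_maximalIdeal _).2 h)
  constructor
  · rw [injective_iff_map_eq_zero]
    intro z hz
    obtain ⟨f, s, rfl⟩ := IsLocalization.exists_mk'_eq
      ((IsLocalRing.maximalIdeal O).comap φ).primeCompl z
    rw [Localization.localRingHom_mk', IsLocalization.mk'_eq_zero_iff] at hz
    obtain ⟨c, hc⟩ := hz
    have h0 : φ f = 0 := (hunit c).mul_left_cancel (by rw [hc, mul_zero])
    have : f = 0 := hinj (by rw [h0, map_zero])
    rw [this, IsLocalization.mk'_zero]
  · intro z
    obtain ⟨o, t, rfl⟩ := IsLocalization.exists_mk'_eq (IsLocalRing.maximalIdeal O).primeCompl z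
    obtain ⟨t', ht'⟩ := hunit t
    obtain ⟨f, s, hs, hfs⟩ := h (o * ↑t'⁻¹)
    have hs' : s ∈ ((IsLocalRing.maximalIdeal O).comap φ).primeCompl := by
      intro h
      exact (IsLocalRing.mem_maximalIdeal _).1 h hs
    refine ⟨IsLocalization.mk' _ f ⟨s, hs'⟩, ?_⟩
    rw [Localization.localRingHom_mk', IsLocalization.mk'_eq_iff_eq]
    congr 1
    rw [← hfs, ← ht']
    simp only
    rw [mul_comm (φ s) o, ← mul_assoc, ← mul_assoc, mul_comm (t' : O) o, mul_assoc o,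
      Units.mul_inv, mul_one]

end LocalRing

theorem isIso_stalkMap_SpecMap_iff {R : CommRingCat.{u}} {O : Type u} [CommRing O] [IsLocalRing O]
    (φ : R ⟶ CommRingCat.of O) :
    IsIso ((Spec.map φ).stalkMap (IsLocalRing.closedPoint O)) ↔
      Function.Bijective (Localization.localRingHom
        ((IsLocalRing.maximalIdeal O).comap φ.hom) (IsLocalRing.maximalIdeal O) φ.hom rfl) := by
  have h1 := MorphismProperty.arrow_mk_iso_iff (MorphismProperty.isomorphisms CommRingCat)
    (Scheme.arrowStalkMapSpecIso φ (IsLocalRing.closedPoint O))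
  rw [MorphismProperty.isomorphisms.iff, MorphismProperty.isomorphisms.iff] at h1
  rw [h1, ConcreteCategory.isIso_iff_bijective]
  rfl

theorem isIso_stalkMap_comp_iff {X Y Z : Scheme.{u}} (f : X ⟶ Y) (g : Y ⟶ Z) [IsOpenImmersion g]
    (x : X) : IsIso ((f ≫ g).stalkMap x) ↔ IsIso (f.stalkMap x) := by
  have : IsIso (Scheme.Hom.stalkMap g (f x)) :=
    (IsOpenImmersion.iff_isIso_stalkMap.1 inferInstance).2 (f x)
  rw [Scheme.Hom.stalkMap_comp]
  exact @isIso_comp_left_iff _ _ _ _ _ _ _ this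

/-- A morphism from the spectrum of a local ring lands in each affine open subscheme that contains
the image of the closed point. -/
theorem exists_factor_fromSpec {O : Type u} [CommRing O] [IsLocalRing O] {W : Scheme.{u}}
    (g : Spec (CommRingCat.of O) ⟶ W) {V : W.Opens} (hV : IsAffineOpen V)
    (hg : g (IsLocalRing.closedPoint O) ∈ V) :
    ∃ γ : Γ(W, V) ⟶ CommRingCat.of O, g = Spec.map γ ≫ hV.fromSpec := by
  have hpre : g ⁻¹ᵁ V = ⊤ := by
    exact (IsLocalRing.closed_point_mem_iff (U := g ⁻¹ᵁ V)).1 hg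
  have hrange : Set.range g ⊆ Set.range hV.fromSpec := by
    rw [hV.range_fromSpec]
    rintro _ ⟨x, rfl⟩
    have : x ∈ g ⁻¹ᵁ V := by rw [hpre]; trivial
    exact this
  refine ⟨Spec.preimage (IsOpenImmersion.lift hV.fromSpec g hrange), ?_⟩
  rw [Spec.map_preimage, IsOpenImmersion.lift_fac]

/-! ### Toric divisors on smooth charts -/

/-- The dual basis of `M`. -/
def dualVector {d : ℕ} (b : Module.Basis (Fin d) ℤ (Fin d → ℤ)) (j : Fin d) : Fin d → ℤ :=
  fun i => b.coord j (Pi.single i 1)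

theorem dualVector_dotProduct {d : ℕ} (b : Module.Basis (Fin d) ℤ (Fin d → ℤ)) (j : Fin d)
    (x : Fin d → ℤ) : dualVector b j ⬝ᵥ x = b.coord j x := by
  rw [LinearMap.pi_apply_eq_sum_univ (b.coord j) x]
  simp only [dotProduct, dualVector, smul_eq_mul]
  refine Finset.sum_congr rfl fun i _ => ?_
  rw [mul_comm]
  congr 2
  ext i'
  simp [Pi.single_apply, eq_comm]

theorem dualVector_dotProduct_basis {d : ℕ} (b : Module.Basis (Fin d) ℤ (Fin d → ℤ))
    (j i : Fin d) : dualVector b j ⬝ᵥ b i = if i = j then 1 else 0 := by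
  rw [dualVector_dotProduct, Module.Basis.coord_apply, Module.Basis.repr_self,
    Finsupp.single_apply]

theorem eq_sum_dualVector {d : ℕ} (b : Module.Basis (Fin d) ℤ (Fin d → ℤ)) (m : Fin d → ℤ) :
    m = ∑ j, (m ⬝ᵥ b j) • dualVector b j := by
  refine dotProduct_eq _ _ fun x => ?_
  rw [sum_dotProduct]
  simp only [smul_dotProduct, dualVector_dotProduct, smul_eq_mul]
  conv_lhs => rw [← b.sum_repr x]
  rw [dotProduct_sum]
  refine Finset.sum_congr rfl fun j _ => ?_
  rw [dotProduct_smul, smul_eq_mul, mul_comm, Module.Basis.coord_apply]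

theorem mem_dualMonoid_hull {d : ℕ} (s : Set (Fin d → ℤ)) (m : Fin d → ℤ) :
    m ∈ dualMonoid (PointedCone.hull ℝ (toReal '' s)) ↔ ∀ n ∈ s, 0 ≤ m ⬝ᵥ n := by
  constructor
  · intro h n hn
    have h1 := h _ (PointedCone.subset_hull ⟨n, hn, rfl⟩)
    rw [pairing_eq_dotProduct, toReal_dotProduct_toReal] at h1
    exact_mod_cast h1
  · intro h
    rw [mem_dualMonoid]
    refine toReal_mem_hull_dotProduct_nonneg _ _ ?_
    rintro _ ⟨n, hn, rfl⟩
    rw [toReal_dotProduct_toReal]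
    exact_mod_cast h n hn

/-! ### The ray of a toric divisor -/

section Chart

variable {k : Type u} [Field k] {d : ℕ} {σ : PointedCone ℝ (Fin d → ℝ)}
  {χ : (Fin d → ℤ) → functionField k σ}

/-- The scheme-theoretic appearance of `O` on an affine chart, in terms of rings: `O` is the
localization of `k[τ^∨ ∩ M]` at the center. Monomials go to characters because each is a quotient of
monomials from `σ^∨ ∩ M`, where `φ` is prescribed. -/
theorem exists_chart_hom (hadd : ∀ m m', χ (m + m') = χ m * χ m')
    (hχ : ∀ a : dualMonoid σ, χ a = algebraMap (coordRing k σ) _ (AddMonoidAlgebra.single a 1))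
    (hA : ∀ m : Fin d → ℤ, ∃ a ∈ dualMonoid σ, m + a ∈ dualMonoid σ)
    {τ : PointedCone ℝ (Fin d → ℝ)} (h : τ ≤ σ) {O : ValuationSubring (functionField k σ)}
    {z : PrimeSpectrum (coordRing k τ)} (H : AppearsAt (chartMap k h) O z) :
    ∃ φ : coordRing k τ →+* functionField k σ,
      (∀ m c, φ (AddMonoidAlgebra.single m c) = c • χ m) ∧ (∀ f, φ f ∈ O) ∧
      (∀ f, f ∈ z.asIdeal ↔ O.valuation (φ f) < 1) ∧
      ∀ o ∈ O, ∃ f s, O.valuation (φ s) = 1 ∧ o * φ s = φ f := by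
  obtain ⟨g, hg, hz, hiso⟩ := H
  obtain ⟨γ, rfl⟩ := Spec.map_surjective g
  have hcomp : (algebraMap O (functionField k σ)).comp (γ.hom.comp
      (AddMonoidAlgebra.mapDomainRingHom k (AddSubmonoid.inclusion (dualMonoid_anti h)))) =
      algebraMap (coordRing k σ) (functionField k σ) := by
    rw [chartMap, ← Spec.map_comp, ← Spec.map_comp] at hg
    exact congrArg CommRingCat.Hom.hom (Spec.map_injective hg)
  have hval : ∀ f, O.valuation (γ.hom f : functionField k σ) = 1 ↔ IsUnit (γ.hom f) := by
    intro f
    rw [O.valuation_eq_one_iff]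
  refine ⟨(algebraMap O (functionField k σ)).comp γ.hom, ?_, ?_, ?_, ?_⟩
  · intro m c
    obtain ⟨a, ha, hma⟩ := hA m
    have hval : ∀ (p : dualMonoid σ) (c : k), (algebraMap O (functionField k σ)) (γ.hom
        (AddMonoidAlgebra.single (AddSubmonoid.inclusion (dualMonoid_anti h) p) c)) = c • χ p := by
      intro p c
      rw [← algebraMap_single hχ, ← hcomp]
      simp only [RingHom.comp_apply, AddMonoidAlgebra.mapDomainRingHom_apply,
        AddMonoidAlgebra.mapDomain_single]
    have h1 := hval ⟨_, hma⟩ c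
    have h2 : (AddMonoidAlgebra.single (AddSubmonoid.inclusion (dualMonoid_anti h) ⟨_, hma⟩) c :
        coordRing k τ) = AddMonoidAlgebra.single m c * AddMonoidAlgebra.single
          (AddSubmonoid.inclusion (dualMonoid_anti h) ⟨a, ha⟩) 1 := by
      rw [AddMonoidAlgebra.single_mul_single, mul_one]
      rfl
    rw [h2, map_mul, map_mul, hval ⟨a, ha⟩ 1, one_smul] at h1
    have h3 := (character_ne_zero hadd hχ).2 a
    refine mul_right_cancel₀ h3 (h1.trans ?_)
    rw [smul_mul_assoc, ← hadd]
  · intro f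
    exact (γ.hom f).2
  · intro f
    have h1 : z.asIdeal = (IsLocalRing.maximalIdeal O).comap γ.hom := by
      rw [← hz]
      rfl
    rw [h1, Ideal.mem_comap]
    exact O.valuation_lt_one_iff _
  · intro o ho
    rw [isIso_stalkMap_SpecMap_iff] at hiso
    obtain ⟨f, s, hs, hfs⟩ := exists_fraction_of_surjective_localRingHom γ.hom hiso.2 ⟨o, ho⟩
    exact ⟨f, s, (hval s).2 hs, congrArg Subtype.val hfs⟩

/-- Multiplication by a suitable monomial carries any element of `k[τ^∨ ∩ M]` into `k[σ^∨ ∩ M]`,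
which embeds in its function field. -/
theorem chart_hom_injective
    (hχ : ∀ a : dualMonoid σ, χ a = algebraMap (coordRing k σ) _ (AddMonoidAlgebra.single a 1))
    (hA : ∀ m : Fin d → ℤ, ∃ a ∈ dualMonoid σ, m + a ∈ dualMonoid σ)
    {τ : PointedCone ℝ (Fin d → ℝ)} (h : τ ≤ σ) (φ : coordRing k τ →+* functionField k σ)
    (hφ : ∀ m c, φ (AddMonoidAlgebra.single m c) = c • χ m) : Function.Injective φ := by
  let i := AddMonoidAlgebra.mapDomainRingHom k (AddSubmonoid.inclusion (dualMonoid_anti h))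
  have hφi : φ.comp i = algebraMap _ _ := by
    refine RingHom.ext fun f => ?_
    induction f using coordRing_induction with
    | h0 => simp
    | hadd f g hf hg => rw [map_add, hf, hg, map_add]
    | hsingle m c =>
      rw [algebraMap_single hχ]
      simp only [i, RingHom.comp_apply, AddMonoidAlgebra.mapDomainRingHom_apply,
        AddMonoidAlgebra.mapDomain_single, hφ]
      rfl
  have key : ∀ f : coordRing k τ, ∃ (a : dualMonoid σ) (g : coordRing k σ),
      i (AddMonoidAlgebra.single a 1) * f = i g := by
    intro f
    induction f using coordRing_induction with
    | h0 => exact ⟨0, 0, by simp⟩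
    | hadd f g hf hg =>
      obtain ⟨a, p, hp⟩ := hf
      obtain ⟨b, q, hq⟩ := hg
      refine ⟨a + b, AddMonoidAlgebra.single b 1 * p + AddMonoidAlgebra.single a 1 * q, ?_⟩
      have : (AddMonoidAlgebra.single (a + b) 1 : coordRing k σ) =
          AddMonoidAlgebra.single a 1 * AddMonoidAlgebra.single b 1 := by
        rw [AddMonoidAlgebra.single_mul_single, mul_one]
      rw [this, map_mul, map_add, map_mul, map_mul, ← hp, ← hq]
      ring
    | hsingle m c =>
      obtain ⟨a, ha, hma⟩ := hA m
      refine ⟨⟨a, ha⟩, AddMonoidAlgebra.single ⟨_, hma⟩ c, ?_⟩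
      simp only [i, AddMonoidAlgebra.mapDomainRingHom_apply, AddMonoidAlgebra.mapDomain_single,
        AddMonoidAlgebra.single_mul_single, one_mul]
      congr 1
      ext1
      exact add_comm _ _
  rw [injective_iff_map_eq_zero]
  intro f hf
  obtain ⟨a, g, hg⟩ := key f
  have h1 : φ (i g) = 0 := by rw [← hg, map_mul, hf, mul_zero]
  have h2 : g = 0 := by
    have h3 := RingHom.congr_fun hφi g
    rw [RingHom.comp_apply, h1] at h3
    exact (FaithfulSMul.algebraMap_eq_zero_iff (coordRing k σ) (functionField k σ)).1 h3.symm
  rw [h2, map_zero] at hg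
  refine (mul_eq_zero.1 hg).resolve_left ?_
  simp only [i, AddMonoidAlgebra.mapDomainRingHom_apply, AddMonoidAlgebra.mapDomain_single]
  rw [AddMonoidAlgebra.single_eq_zero]
  exact one_ne_zero

/-- A torus-invariant prime of height one is nonzero, hence contains a monomial. This excludes the
trivial valuation and divisors that meet the torus. -/
theorem exists_character_valuation_lt_one (hadd : ∀ m m', χ (m + m') = χ m * χ m')
    (hχ : ∀ a : dualMonoid σ, χ a = algebraMap (coordRing k σ) _ (AddMonoidAlgebra.single a 1))
    (hA : ∀ m : Fin d → ℤ, ∃ a ∈ dualMonoid σ, m + a ∈ dualMonoid σ)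
    {O : ValuationSubring (functionField k σ)} (hO : IsToricDivisor O) :
    ∃ m, O.valuation (χ m) < 1 := by
  obtain ⟨τ, h, P, -, -, hht, hinv, happ⟩ := hO
  obtain ⟨φ, hφ, -, hP, -⟩ := exists_chart_hom hadd hχ hA h happ
  have hne : P.asIdeal ≠ ⊥ := by
    intro h0
    rw [h0, Ideal.height_bot] at hht
    exact zero_ne_one hht
  obtain ⟨f, hf, hf0⟩ := Submodule.exists_mem_ne_zero_of_ne_bot hne
  obtain ⟨m, hm⟩ : ∃ m, f.coeff m ≠ 0 := by
    by_contra! hall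
    exact hf0 (AddMonoidAlgebra.coeff_eq_zero.1 (Finsupp.ext hall))
  have h1 := (hP _).1 (hinv f hf m hm)
  rw [hφ, one_smul] at h1
  exact ⟨m, h1⟩

/-- The dual basis vectors act as coordinates on the smooth chart. Not all of them are units of `O`,
since some monomial is not; two cannot both be nonunits, since a valuation ring contains one of
their two quotients. The index of the only nonunit is the ray. -/
theorem exists_ray_of_appearsAt (hadd : ∀ m m', χ (m + m') = χ m * χ m')
    (hχ : ∀ a : dualMonoid σ, χ a = algebraMap (coordRing k σ) _ (AddMonoidAlgebra.single a 1))
    (hA : ∀ m : Fin d → ℤ, ∃ a ∈ dualMonoid σ, m + a ∈ dualMonoid σ)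
    {O : ValuationSubring (functionField k σ)} (hO : IsToricDivisor O)
    (b : Module.Basis (Fin d) ℤ (Fin d → ℤ)) (s : Set (Fin d)) {τ : PointedCone ℝ (Fin d → ℝ)}
    (hτ : τ = PointedCone.hull ℝ ((fun i => toReal (b i)) '' s)) (h : τ ≤ σ)
    (φ : coordRing k τ →+* functionField k σ)
    (hφ : ∀ m c, φ (AddMonoidAlgebra.single m c) = c • χ m) (hφO : ∀ f, φ f ∈ O)
    (hfrac : ∀ o ∈ O, ∃ f s, O.valuation (φ s) = 1 ∧ o * φ s = φ f) :
    ∃ i ∈ s, ∀ m : Fin d → ℤ, 0 ≤ m ⬝ᵥ b i → χ m ∈ O := by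
  obtain ⟨hχ0, hχne⟩ := character_ne_zero hadd hχ
  have hmem : ∀ m : Fin d → ℤ, m ∈ dualMonoid τ ↔ ∀ j ∈ s, 0 ≤ m ⬝ᵥ b j := by
    intro m
    rw [hτ, show (fun i => toReal (b i)) '' s = toReal '' (b '' s) by rw [Set.image_image],
      mem_dualMonoid_hull]
    simp
  have hmemO : ∀ m ∈ dualMonoid τ, χ m ∈ O := by
    intro m hm
    have := hφO (AddMonoidAlgebra.single ⟨m, hm⟩ 1)
    rwa [hφ, one_smul] at this
  let U : AddSubgroup (Fin d → ℤ) :=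
    { carrier := {m | O.valuation (χ m) = 1}
      zero_mem' := by
        change O.valuation (χ 0) = 1
        rw [hχ0, map_one]
      add_mem' := by
        intro p q (hp : O.valuation (χ p) = 1) (hq : O.valuation (χ q) = 1)
        change O.valuation (χ (p + q)) = 1
        rw [hadd, map_mul, hp, hq, one_mul]
      neg_mem' := by
        intro p (hp : O.valuation (χ p) = 1)
        change O.valuation (χ (-p)) = 1
        have : O.valuation (χ p) * O.valuation (χ (-p)) = 1 := by
          rw [← map_mul, ← hadd, add_neg_cancel, hχ0, map_one]
        rwa [hp, one_mul] at this }
  have hdual : ∀ j, dualVector b j ∈ dualMonoid τ := by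
    intro j
    rw [hmem]
    intro i _
    rw [dualVector_dotProduct_basis]
    split_ifs <;> simp
  have hle : ∀ j, O.valuation (χ (dualVector b j)) ≤ 1 := fun j =>
    (O.valuation_le_one_iff _).2 (hmemO _ (hdual j))
  have hout : ∀ j, j ∉ s → dualVector b j ∈ U := by
    intro j hj
    have h1 : -dualVector b j ∈ dualMonoid τ := by
      rw [hmem]
      intro i hi
      rw [neg_dotProduct, dualVector_dotProduct_basis, if_neg (by rintro rfl; exact hj hi),
        neg_zero]
    have h2 := (O.valuation_le_one_iff _).2 (hmemO _ h1)
    have h3 : O.valuation (χ (dualVector b j)) * O.valuation (χ (-dualVector b j)) = 1 := by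
      rw [← map_mul, ← hadd, add_neg_cancel, hχ0, map_one]
    refine le_antisymm (hle j) ?_
    rw [← h3]
    exact mul_le_of_le_one_right' h2
  -- If the quotient of the coordinates were `f / t`, then coordinate `j` times `t` would equal
  -- coordinate `i` times `f`, so every monomial of `t` would be divisible by coordinate `i`. Then
  -- `t` would not be a unit of `O`.
  have hexcl : ∀ i j, i ∈ s → i ≠ j → O.valuation (χ (dualVector b i)) < 1 →
      χ (dualVector b j - dualVector b i) ∉ O := by
    intro i j hi hij hlt hmemij
    obtain ⟨f, t, ht, hft⟩ := hfrac _ hmemij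
    have h1 : AddMonoidAlgebra.single ⟨_, hdual j⟩ 1 * t =
        AddMonoidAlgebra.single ⟨_, hdual i⟩ 1 * f := by
      apply chart_hom_injective hχ hA h φ hφ
      rw [map_mul, map_mul, hφ, hφ, one_smul, one_smul, ← hft, ← mul_assoc, ← hadd]
      simp
    have h2 : ∀ e ∈ t.coeff.support, 1 ≤ (e : Fin d → ℤ) ⬝ᵥ b i := by
      intro e he
      have h3 : (AddMonoidAlgebra.single (⟨_, hdual i⟩ : dualMonoid τ) (1 : k) * f).coeff
          (⟨_, hdual j⟩ + e) ≠ 0 := by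
        rw [← h1, AddMonoidAlgebra.coeff_single_mul_add, one_mul]
        exact Finsupp.mem_support_iff.1 he
      have h4 : ∃ e' : dualMonoid τ, (⟨_, hdual i⟩ : dualMonoid τ) + e' = ⟨_, hdual j⟩ + e := by
        by_contra! hne
        refine h3 ?_
        exact AddMonoidAlgebra.coeff_single_mul_of_forall_add_ne _ _ hne
      obtain ⟨e', he'⟩ := h4
      have h5 := congrArg (fun x : dualMonoid τ => (x : Fin d → ℤ) ⬝ᵥ b i) he'
      simp only [AddSubmonoid.coe_add, add_dotProduct, dualVector_dotProduct_basis, if_true,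
        if_neg hij] at h5
      have h6 := (hmem _).1 e'.2 i hi
      omega
    have h3 : O.valuation (φ t) < 1 := by
      rw [← AddMonoidAlgebra.sum_coeff_single t, Finsupp.sum, map_sum]
      refine O.valuation.map_sum_lt one_ne_zero fun e he => ?_
      have h4 : χ ((e : Fin d → ℤ) - dualVector b i) ∈ O := by
        refine hmemO _ ((hmem _).2 fun j' hj' => ?_)
        rw [sub_dotProduct, dualVector_dotProduct_basis]
        split_ifs with hji
        · subst hji
          linarith [h2 e he]
        · linarith [(hmem _).1 e.2 j' hj']
      have h5 : φ (AddMonoidAlgebra.single e (t.coeff e)) =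
          φ (AddMonoidAlgebra.single 0 (t.coeff e)) * χ ((e : Fin d → ℤ) - dualVector b i) *
            χ (dualVector b i) := by
        rw [mul_assoc, ← hadd, sub_add_cancel, hφ, hφ, AddSubmonoid.coe_zero, hχ0,
          smul_mul_assoc, one_mul]
      rw [h5, mul_comm, map_mul]
      exact mul_lt_one_of_lt_of_le hlt ((O.valuation_le_one_iff _).2 (mul_mem (hφO _) h4))
    rw [ht] at h3
    exact lt_irrefl _ h3
  obtain ⟨i, hiU⟩ : ∃ i, dualVector b i ∉ U := by
    by_contra! hall
    obtain ⟨m, hm⟩ := exists_character_valuation_lt_one hadd hχ hA hO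
    have : m ∈ U := by
      rw [eq_sum_dualVector b m]
      exact sum_mem fun j _ => zsmul_mem (hall j) _
    exact hm.ne this
  have his : i ∈ s := by
    by_contra hi
    exact hiU (hout i hi)
  have hilt : O.valuation (χ (dualVector b i)) < 1 := lt_of_le_of_ne (hle i) hiU
  have hothers : ∀ j, j ≠ i → dualVector b j ∈ U := by
    intro j hji
    by_contra hjU
    have hjs : j ∈ s := by
      by_contra hj
      exact hjU (hout j hj)
    have hjlt : O.valuation (χ (dualVector b j)) < 1 := lt_of_le_of_ne (hle j) hjU
    rcases O.mem_or_inv_mem (χ (dualVector b j - dualVector b i)) with h1 | h1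
    · exact hexcl i j his hji.symm hilt h1
    · refine hexcl j i hjs hji hjlt ?_
      have h2 : χ (dualVector b i - dualVector b j) = (χ (dualVector b j - dualVector b i))⁻¹ := by
        refine eq_inv_of_mul_eq_one_left ?_
        rw [← hadd]
        simp [hχ0]
      rwa [h2]
  refine ⟨i, his, fun m hm => ?_⟩
  obtain ⟨N, hN⟩ := Int.eq_ofNat_of_zero_le hm
  have h1 : m - N • dualVector b i ∈ U := by
    rw [eq_sum_dualVector b (m - N • dualVector b i)]
    refine sum_mem fun j _ => ?_
    by_cases hj : j = i
    · subst hj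
      rw [sub_dotProduct, smul_dotProduct, dualVector_dotProduct_basis, if_pos rfl, hN]
      simp
    · exact zsmul_mem (hothers j hj) _
  have h2 : m = (m - N • dualVector b i) + N • dualVector b i := by abel
  rw [h2, hadd, character_nsmul hadd hχ0]
  exact mul_mem ((O.valuation_le_one_iff _).1 (le_of_eq h1)) (pow_mem (hmemO _ (hdual i)) N)

end Chart

section Subdivision

open Filter Topology

/-! ### Moderate subdivisions -/

/-- A line not contained in `W` meets it for at most one parameter. -/
theorem eventually_add_smul_notMem {V : Type*} [AddCommGroup V] [Module ℝ V] (W : Submodule ℝ V)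
    {p q : V} (h : ¬ (p ∈ W ∧ q ∈ W)) : ∀ᶠ t : ℝ in 𝓝[>] 0, p + t • q ∉ W := by
  by_cases hex : ∃ t₀ : ℝ, 0 < t₀ ∧ p + t₀ • q ∈ W
  · obtain ⟨t₀, ht₀, hmem⟩ := hex
    filter_upwards [Ioo_mem_nhdsGT ht₀] with t ht hmem'
    have h1 : (t₀ - t) • q ∈ W := by
      have := sub_mem hmem hmem'
      rwa [add_sub_add_left_eq_sub, ← sub_smul] at this
    have hq : q ∈ W := (W.smul_mem_iff (sub_pos.2 ht.2).ne').1 h1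
    exact h ⟨(W.add_mem_iff_left (W.smul_mem _ hq)).1 hmem, hq⟩
  · push Not at hex
    filter_upwards [self_mem_nhdsWithin] with t ht
    exact hex t ht

/-- A spanning cone is not covered by finitely many proper subspaces: a point that avoids some of
them is perturbed slightly inside the cone to avoid one more. -/
theorem exists_mem_forall_notMem {V : Type*} [AddCommGroup V] [Module ℝ V]
    (σ : PointedCone ℝ V) (hσ : Submodule.span ℝ (σ : Set V) = ⊤) {F : Set (Submodule ℝ V)}
    (hF : F.Finite) (hFtop : ⊤ ∉ F) : ∃ q ∈ σ, ∀ W ∈ F, q ∉ W := by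
  induction F, hF using Set.Finite.induction_on with
  | empty => exact ⟨0, zero_mem _, by simp⟩
  | @insert W F hWF hF ih =>
    obtain ⟨q, hq, hqF⟩ := ih (fun h => hFtop (Set.mem_insert_of_mem _ h))
    obtain ⟨v, hv, hvW⟩ : ∃ v ∈ σ, v ∉ W := by
      by_contra! hall
      refine hFtop (Set.mem_insert_iff.2 (Or.inl ?_))
      rw [eq_comm, ← top_le_iff, ← hσ]
      exact Submodule.span_le.2 hall
    have h1 := eventually_add_smul_notMem W (p := q) (q := v) (fun h => hvW h.2)
    have h2 : ∀ᶠ t : ℝ in 𝓝[>] 0, ∀ W' ∈ F, q + t • v ∉ W' :=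
      (eventually_all_finite hF).2 fun W' hW' =>
        eventually_add_smul_notMem W' (fun h => hqF W' hW' h.1)
    obtain ⟨t, ⟨ht1, ht2⟩, ht0⟩ := ((h1.and h2).and self_mem_nhdsWithin).exists
    refine ⟨q + t • v, add_mem hq (σ.smul_mem (le_of_lt ht0) hv), ?_⟩
    rintro W' (rfl | hW')
    · exact ht1
    · exact ht2 W' hW'

theorem exists_fun_of_mem_hull_range {V ι : Type*} [AddCommGroup V] [Module ℝ V] [Fintype ι]
    {v : ι → V} {x : V} (hx : x ∈ PointedCone.hull ℝ (Set.range v)) :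
    ∃ c : ι → ℝ, (∀ i, 0 ≤ c i) ∧ ∑ i, c i • v i = x := by
  obtain ⟨c, hc⟩ := (Submodule.mem_span_range_iff_exists_fun _).1 hx
  exact ⟨fun i => c i, fun i => (c i).2, hc⟩

theorem toReal_eq_sum_basis {d : ℕ} (b : Module.Basis (Fin d) ℤ (Fin d → ℤ)) (x : Fin d → ℝ) :
    ∑ j, (toReal (dualVector b j) ⬝ᵥ x) • toReal (b j) = x := by
  have key : ∀ y : Fin d → ℤ, ∑ j, (toReal (dualVector b j) ⬝ᵥ toReal y) • toReal (b j) =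
      toReal y := by
    intro y
    conv_rhs => rw [← b.sum_repr y]
    ext i
    simp only [toReal_dotProduct_toReal, dualVector_dotProduct, Module.Basis.coord_apply,
      Finset.sum_apply, Pi.smul_apply, toReal, smul_eq_mul]
    push_cast
    rfl
  let L : (Fin d → ℝ) →ₗ[ℝ] (Fin d → ℝ) :=
    { toFun := fun x => ∑ j, (toReal (dualVector b j) ⬝ᵥ x) • toReal (b j)
      map_add' := fun x y => by
        simp only [dotProduct_add, add_smul, Finset.sum_add_distrib]
      map_smul' := fun c x => by
        simp only [dotProduct_smul, smul_assoc, Finset.smul_sum, RingHom.id_apply] }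
  have hL : L = LinearMap.id := by
    refine (Pi.basisFun ℝ (Fin d)).ext fun i => ?_
    have h1 : (Pi.basisFun ℝ (Fin d)) i = toReal (Pi.single i 1) := by
      ext i'
      simp only [Pi.basisFun_apply, toReal, Pi.single_apply]
      split_ifs <;> simp
    rw [h1]
    exact key _
  exact LinearMap.congr_fun hL x

theorem mem_hull_basis_iff {d : ℕ} (b : Module.Basis (Fin d) ℤ (Fin d → ℤ)) (x : Fin d → ℝ) :
    x ∈ PointedCone.hull ℝ (Set.range fun i => toReal (b i)) ↔
      ∀ j, 0 ≤ toReal (dualVector b j) ⬝ᵥ x := by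
  constructor
  · intro hx j
    refine toReal_mem_hull_dotProduct_nonneg _ _ ?_ x hx
    rintro _ ⟨i, rfl⟩
    rw [toReal_dotProduct_toReal, dualVector_dotProduct_basis]
    split_ifs <;> simp
  · intro h
    rw [← toReal_eq_sum_basis b x]
    exact sum_mem fun j _ => PointedCone.smul_mem _ (h j) (PointedCone.subset_hull ⟨j, rfl⟩)

/-- A face contains every generator that occurs with positive coefficient in one of its points. -/
theorem IsFaceOf.eq_hull {d : ℕ} {b : Module.Basis (Fin d) ℤ (Fin d → ℤ)}
    {τ : PointedCone ℝ (Fin d → ℝ)}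
    (h : τ.IsFaceOf (PointedCone.hull ℝ (Set.range fun i => toReal (b i)))) :
    ∃ s : Set (Fin d), τ = PointedCone.hull ℝ ((fun i => toReal (b i)) '' s) := by
  refine ⟨{i | toReal (b i) ∈ τ}, le_antisymm (fun x hx => ?_) ?_⟩
  · obtain ⟨c, hc, rfl⟩ := exists_fun_of_mem_hull_range (h.le hx)
    refine sum_mem fun i _ => ?_
    rcases (hc i).eq_or_lt with h0 | hpos
    · rw [← h0, zero_smul]
      exact zero_mem _
    · refine PointedCone.smul_mem _ (hc i) (PointedCone.subset_hull ⟨i, ?_, rfl⟩)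
      exact h.mem_of_sum_smul_mem (fun i => PointedCone.subset_hull ⟨i, rfl⟩) hc hx i hpos
  · refine Submodule.span_le.2 ?_
    rintro _ ⟨i, hi, rfl⟩
    exact hi

/-- With `q ∈ σ` outside the spans of the lower-dimensional cones, `p + t q` for small `t > 0`
avoids those cones. If `p` were in no full-dimensional cone, these being closed, `p + t q` would
avoid them too and leave the support. -/
theorem Fan.IsModerate.exists_nondegenerate {d : ℕ} {S : Fan d} {σ : PointedCone ℝ (Fin d → ℝ)}
    (hS : S.IsModerate σ) (hσ : IsNondegenerate σ) {p : Fin d → ℝ} (hp : p ∈ σ) :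
    ∃ τ ∈ S.cones, IsNondegenerate τ ∧ p ∈ τ := by
  by_contra! hcon
  obtain ⟨q, hq, hqW⟩ := exists_mem_forall_notMem σ hσ
    (F := (fun τ : PointedCone ℝ (Fin d → ℝ) => Submodule.span ℝ (τ : Set (Fin d → ℝ))) ''
      {τ ∈ S.cones | ¬ IsNondegenerate τ}) ((S.finite.subset (Set.sep_subset _ _)).image _) (by
      rintro ⟨τ, ⟨-, hτ⟩, h⟩
      exact hτ h)
  have key : ∀ᶠ t : ℝ in 𝓝[>] 0, ∀ τ ∈ S.cones, p + t • q ∉ τ := by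
    refine (eventually_all_finite S.finite).2 fun τ hτ => ?_
    by_cases hnd : IsNondegenerate τ
    · obtain ⟨b, hb, -⟩ := hS.2 τ hτ hnd
      have h1 := hcon τ hτ hnd
      rw [hb, mem_hull_basis_iff] at h1
      push Not at h1
      obtain ⟨j, hj⟩ := h1
      have hcont : Tendsto (fun t : ℝ => toReal (dualVector b j) ⬝ᵥ (p + t • q)) (𝓝[>] 0)
          (𝓝 (toReal (dualVector b j) ⬝ᵥ p)) := by
        have : Continuous fun t : ℝ => toReal (dualVector b j) ⬝ᵥ (p + t • q) := by
          simp only [dotProduct_add, dotProduct_smul, smul_eq_mul]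
          fun_prop
        have h2 := this.tendsto 0
        simp only [zero_smul, add_zero] at h2
        exact h2.mono_left nhdsWithin_le_nhds
      filter_upwards [hcont.eventually (gt_mem_nhds hj)] with t ht hmem
      rw [hb, mem_hull_basis_iff] at hmem
      exact absurd (hmem j) (not_le.2 ht)
    · have h1 := hqW _ ⟨τ, ⟨hτ, hnd⟩, rfl⟩
      filter_upwards [eventually_add_smul_notMem _ (p := p) (fun h => h1 h.2)] with t ht hmem
      exact ht (Submodule.subset_span hmem)
  obtain ⟨t, ht, ht0⟩ := (key.and self_mem_nhdsWithin).exists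
  have hmem : p + t • q ∈ (σ : Set (Fin d → ℝ)) := add_mem hp (σ.smul_mem (le_of_lt ht0) hq)
  rw [← hS.1] at hmem
  simp only [Set.mem_iUnion] at hmem
  obtain ⟨τ, hτ, h⟩ := hmem
  exact ht τ hτ h

/-- The faces of the full-dimensional cones of a fan. -/
def Fan.pureSubfan {d : ℕ} (S : Fan d) : Fan d where
  cones := {τ ∈ S.cones | ∃ τ' ∈ S.cones, IsNondegenerate τ' ∧ τ.IsFaceOf τ'}
  finite := S.finite.subset (Set.sep_subset _ _)
  rational τ hτ := S.rational τ hτ.1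
  stronglyConvex τ hτ := S.stronglyConvex τ hτ.1
  face_mem := by
    rintro τ ⟨hτ, τ', hτ', hnd, hface⟩ ρ hρ
    exact ⟨S.face_mem τ hτ ρ hρ, τ', hτ', hnd, hρ.trans hface⟩
  inter_face τ hτ τ' hτ' := S.inter_face τ hτ.1 τ' hτ'.1

/-- Moderateness constrains only the full-dimensional cones. Their faces already cover `σ` and are
smooth, so essential divisors can be tested on this subfan. -/
theorem Fan.IsModerate.isSmoothSubdivision_pureSubfan {d : ℕ} {S : Fan d}
    {σ : PointedCone ℝ (Fin d → ℝ)} (hS : S.IsModerate σ) (hσ : IsNondegenerate σ) :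
    S.pureSubfan.IsSmoothSubdivision σ := by
  refine ⟨Set.Subset.antisymm ?_ ?_, ?_⟩
  · rw [← hS.1]
    exact Set.biUnion_subset_biUnion_left fun τ hτ => hτ.1
  · intro p hp
    obtain ⟨τ, hτ, hnd, hpτ⟩ := hS.exists_nondegenerate hσ hp
    exact Set.mem_biUnion (⟨hτ, τ, hτ, hnd, .refl _⟩ : τ ∈ S.pureSubfan.cones) hpτ
  · rintro τ ⟨-, τ', hτ', hnd, hface⟩
    obtain ⟨b, rfl, -⟩ := hS.2 τ' hτ' hnd
    obtain ⟨s, hs⟩ := IsFaceOf.eq_hull hface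
    exact ⟨b, s, hs⟩

/-- The functional `ψ_τ` is the sum of the dual basis, hence integral. -/
theorem SupportsVertex.pos {d : ℕ} {b : Module.Basis (Fin d) ℤ (Fin d → ℤ)}
    {σ : PointedCone ℝ (Fin d → ℝ)} (h : SupportsVertex b σ) :
    ∀ x ∈ σ, x ≠ 0 → 0 < toReal (∑ j, dualVector b j) ⬝ᵥ x := by
  obtain ⟨ψ, h1, h2, h3⟩ := h
  have key : ∀ x, ψ x = toReal (∑ j, dualVector b j) ⬝ᵥ x := by
    intro x
    conv_lhs => rw [← toReal_eq_sum_basis b x]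
    simp only [map_sum, map_smul, h1, smul_eq_mul, mul_one]
    rw [← sum_dotProduct]
    congr 1
    ext i
    simp [toReal]
  intro x hx hx0
  rw [← key]
  exact lt_of_le_of_ne (h2 x hx) fun h => hx0 (h3 x hx h.symm)

end Subdivision

/-! ### Function fields of birational models and flat pullbacks -/

/-- A birational morphism to an integral affine scheme induces an isomorphism of function
fields. -/
theorem exists_functionField_hom {R K : Type u} [CommRing R] [IsDomain R] [Field K] [Algebra R K]
    [IsFractionRing R K] {Y : Scheme.{u}} [IsIntegral Y] (f : Y ⟶ Spec (CommRingCat.of R))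
    (hf : Scheme.BirationalOver f (𝟙 _)) :
    ∃ κ : Y.presheaf.stalk (genericPoint Y) ⟶ CommRingCat.of K, Function.Bijective κ.hom ∧
      Spec.map κ ≫ Y.fromSpecStalk (genericPoint Y) ≫ f =
        Spec.map (CommRingCat.ofHom (algebraMap R K)) := by
  obtain ⟨e, he⟩ := hf
  have hs : Nonempty e.source := e.dense_source.nonempty.to_subtype
  have ht : Nonempty e.target := e.dense_target.nonempty.to_subtype
  let p : Spec (CommRingCat.of K) ⟶ Spec (CommRingCat.of R) :=
    Spec.map (CommRingCat.ofHom (algebraMap R K))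
  have hp : ∀ x, p x = genericPoint (Spec (CommRingCat.of R)) := by
    intro x
    rw [genericPoint_eq_bot_of_affine]
    apply PrimeSpectrum.ext
    have hx : x = (⊥ : PrimeSpectrum K) := Subsingleton.elim _ _
    rw [hx]
    change (⊥ : Ideal K).comap (algebraMap R K) = ⊥
    exact Ideal.comap_bot_of_injective _ (IsFractionRing.injective R K)
  have hrange : Set.range p ⊆ Set.range e.target.ι := by
    rintro _ ⟨x, rfl⟩
    rw [hp, ← genericPoint_eq_of_isOpenImmersion e.target.ι]
    exact ⟨_, rfl⟩
  -- The inverse of `f` on the open sets where it is an isomorphism, restricted to the generic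
  -- point.
  let q : Spec (CommRingCat.of K) ⟶ Y :=
    IsOpenImmersion.lift e.target.ι p hrange ≫ e.iso.inv ≫ e.source.ι
  have hq : q ≫ f = p := by
    simp only [q, Category.assoc]
    rw [← he, Iso.inv_hom_id_assoc, Category.comp_id, IsOpenImmersion.lift_fac]
  have hqx : ∀ x, q x = genericPoint Y := by
    intro x
    have h1 : IsOpenImmersion.lift e.target.ι p hrange x = genericPoint e.target := by
      apply e.target.ι.isOpenEmbedding.injective
      rw [genericPoint_eq_of_isOpenImmersion, ← hp x, ← Scheme.Hom.comp_apply,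
        IsOpenImmersion.lift_fac]
    simp only [q, Scheme.Hom.comp_apply]
    rw [h1, genericPoint_eq_of_isOpenImmersion, genericPoint_eq_of_isOpenImmersion]
  obtain ⟨κ, hκ⟩ : ∃ κ : Y.presheaf.stalk (genericPoint Y) ⟶ CommRingCat.of K,
      Spec.map κ ≫ Y.fromSpecStalk (genericPoint Y) = q := by
    rw [← hqx (IsLocalRing.closedPoint K)]
    exact ⟨_, Scheme.Spec_stalkClosedPointTo_fromSpecStalk q⟩
  have hκf : Spec.map κ ≫ Y.fromSpecStalk (genericPoint Y) ≫ f = p := by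
    rw [← hq, ← hκ, Category.assoc]
  refine ⟨κ, ⟨?_, ?_⟩, hκf⟩
  · let : Field (Y.presheaf.stalk (genericPoint Y)) := inferInstanceAs (Field Y.functionField)
    exact κ.hom.injective
  · let : Field (Y.presheaf.stalk (genericPoint Y)) := inferInstanceAs (Field Y.functionField)
    -- The image of `κ` is a subfield that contains `R`, hence is all of `K`.
    have hR : ∀ r, algebraMap R K r ∈ κ.hom.fieldRange := by
      intro r
      have h1 : Spec.preimage (Y.fromSpecStalk (genericPoint Y) ≫ f) ≫ κ =
          CommRingCat.ofHom (algebraMap R K) := by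
        apply Spec.map_injective
        rw [Spec.map_comp, Spec.map_preimage, hκf]
      exact ⟨_, congr($(h1).hom r)⟩
    intro t
    obtain ⟨a, b, -, rfl⟩ := IsFractionRing.div_surjective (A := R) t
    exact div_mem (hR a) (hR b)

/-- The section rings of a pullback along a morphism of affine schemes, and of its reduction. -/
theorem exists_isPushout_of_reducedPullbackFlat {X Y W : Scheme.{u}} [IsAffine X] [IsAffine W]
    {f : Y ⟶ X} {F : W ⟶ X} (h : ReducedPullbackFlat f F) {U : Y.Opens} (hU : IsAffineOpen U) :
    ∃ (E Q : CommRingCat.{u}) (inl : Γ(Y, U) ⟶ E) (inr : Γ(W, ⊤) ⟶ E) (ρ : E ⟶ Q),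
      IsPushout (f.appLE ⊤ U le_top) F.appTop inl inr ∧ Function.Surjective ρ.hom ∧
        (∀ x, ρ.hom x = 0 → IsNilpotent x) ∧ (inl ≫ ρ).hom.Flat := by
  have hF : IsAffineHom F := inferInstance
  have hfst : IsAffineHom (pullback.fst f F) :=
    isAffineHom_isStableUnderBaseChange.of_isPullback (IsPullback.of_hasPullback f F).flip hF
  have hV : IsAffineOpen (pullback.fst f F ⁻¹ᵁ U) := hU.preimage _
  have hp := (isIso_pushoutSection_iff (IsPullback.of_hasPullback f F) (US := ⊤) (UX := U)
    (UT := ⊤) (UY := pullback.fst f F ⁻¹ᵁ U) le_top le_top (by simp)).1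
    (isIso_pushoutSection_of_isAffineOpen _ _ _ _ (isAffineOpen_top _) (isAffineOpen_top _) hU)
  refine ⟨_, _, (pullback.fst f F).appLE U _ le_rfl, (pullback.snd f F).appLE ⊤ _ le_top,
    (pullback f F).nilradical.subschemeι.app (pullback.fst f F ⁻¹ᵁ U), ?_,
    (pullback f F).nilradical.subschemeι_app_surjective ⟨_, hV⟩, ?_, ?_⟩
  · simpa [Scheme.Hom.appTop, Scheme.Hom.app_eq_appLE] using hp
  · intro x hx
    have h1 : x ∈ (pullback f F).nilradical.ideal ⟨_, hV⟩ := by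
      rw [← Scheme.IdealSheafData.ker_subschemeι_app]
      exact hx
    exact h1
  · have hfl : Flat ((pullback f F).nilradical.subschemeι ≫ pullback.fst f F) := h
    have h1 := hfl.flat_appLE hU (hV.preimage (pullback f F).nilradical.subschemeι) le_rfl
    convert h1 using 2
    rw [Scheme.Hom.app_eq_appLE, Scheme.Hom.appLE_comp_appLE]

theorem SpecMap_ΓSpecIso_fromSpec (R : CommRingCat.{u}) {P : (Spec R).Opens} (hP : P = ⊤)
    (hPaff : IsAffineOpen P) :
    Spec.map ((Spec R).presheaf.map (eqToHom hP.symm).op ≫ (Scheme.ΓSpecIso R).hom) ≫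
      hPaff.fromSpec = 𝟙 _ := by
  subst hP
  rw [IsAffineOpen.fromSpec_top, Iso.comp_inv_eq, Scheme.isoSpec_Spec_hom]
  simp

/-- The normalization, near the center of a valuation ring. -/
theorem exists_normalization_chart {Y : Scheme.{u}} [IsIntegral Y] [QuasiSeparatedSpace Y]
    {K : Type u} [Field K] (κ : Y.presheaf.stalk (genericPoint Y) ⟶ CommRingCat.of K)
    (hκ : Function.Bijective κ.hom) {O : ValuationSubring K}
    (g : Spec (CommRingCat.of O) ⟶ (Y.fromSpecStalk (genericPoint Y)).normalization)
    (hg : Spec.map (CommRingCat.ofHom (algebraMap O K)) ≫ g =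
      Spec.map κ ≫ (Y.fromSpecStalk (genericPoint Y)).toNormalization) :
    ∃ (U : Y.Opens) (_ : IsAffineOpen U) (hV : IsAffineOpen (normalizationMap Y ⁻¹ᵁ U))
      (γ : Γ((Y.fromSpecStalk (genericPoint Y)).normalization, normalizationMap Y ⁻¹ᵁ U) ⟶
        CommRingCat.of O),
      g = Spec.map γ ≫ hV.fromSpec ∧
      Function.Injective γ.hom ∧ Function.Injective (((normalizationMap Y).app U) ≫ γ).hom ∧
      ∀ t : K, ∀ N : ℕ, 0 < N →
        (∃ b, algebraMap O K (((normalizationMap Y).app U ≫ γ).hom b) = t ^ N) →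
          ∃ c, algebraMap O K (γ.hom c) = t := by
  let η := genericPoint Y
  let j := Y.fromSpecStalk η
  obtain ⟨_, ⟨U, hU, rfl⟩, hxU, -⟩ := Y.isBasis_affineOpens.exists_subset_of_mem_open
    (Set.mem_univ (normalizationMap Y (g (IsLocalRing.closedPoint O)))) isOpen_univ
  have hV := hU.preimage j.fromNormalization
  obtain ⟨γ, hγ⟩ := exists_factor_fromSpec g hV hxU
  have hη : η ∈ U := ((genericPoint_spec Y).mem_open_set_iff U.isOpen).2 ⟨_, trivial, hxU⟩
  let : Field (Y.presheaf.stalk η) := inferInstanceAs (Field Y.functionField)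
  have hP : j ⁻¹ᵁ U = ⊤ := by
    refine (IsLocalRing.closed_point_mem_iff (U := j ⁻¹ᵁ U)).1 ?_
    change j (IsLocalRing.closedPoint _) ∈ U
    rw [Scheme.fromSpecStalk_closedPoint]
    exact hη
  have hPaff : IsAffineOpen (j ⁻¹ᵁ U) := by rw [hP]; exact isAffineOpen_top _
  -- The preimage of `U` in the spectrum of the function field is everything, so `ε` identifies its
  -- sections with the function field.
  let ε : Γ(Spec (Y.presheaf.stalk η), j ⁻¹ᵁ U) ⟶ Y.presheaf.stalk η :=
    (Spec (Y.presheaf.stalk η)).presheaf.map (eqToHom hP.symm).op ≫ (Scheme.ΓSpecIso _).hom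
  have hε : Function.Bijective ε.hom :=
    (ConcreteCategory.isIso_iff_bijective ε).1 inferInstance
  have hle : j ⁻¹ᵁ U ≤ j.toNormalization ⁻¹ᵁ (j.fromNormalization ⁻¹ᵁ U) := by
    simp [← Scheme.Hom.comp_preimage]
  let δ : Γ(j.normalization, j.fromNormalization ⁻¹ᵁ U) ⟶ Y.presheaf.stalk η :=
    j.toNormalization.appLE _ _ hle ≫ ε
  have hδ : Spec.map δ ≫ hV.fromSpec = j.toNormalization := by
    have h1 := IsAffineOpen.SpecMap_appLE_fromSpec j.toNormalization hV hPaff hle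
    have h2 : Spec.map ε ≫ hPaff.fromSpec = 𝟙 _ := SpecMap_ΓSpecIso_fromSpec _ hP hPaff
    simp only [δ, Spec.map_comp, Category.assoc]
    rw [h1, reassoc_of% h2]
  have hγδ : γ ≫ CommRingCat.ofHom (algebraMap O K) = δ ≫ κ := by
    apply Spec.map_injective
    rw [← cancel_mono hV.fromSpec, Spec.map_comp, Spec.map_comp, Category.assoc, Category.assoc,
      ← hγ, hδ, hg]
  have hfac : j.fromNormalization.app U ≫ j.toNormalization.appLE _ _ hle = j.app U := by
    rw [j.fromNormalization.app_eq_appLE, Scheme.Hom.appLE_comp_appLE, j.app_eq_appLE]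
    congr 1
    exact j.toNormalization_fromNormalization
  have hcomp : (normalizationMap Y).app U ≫ δ = j.app U ≫ ε := by
    rw [← hfac, Category.assoc]
    rfl
  let := (j.app U).hom.toAlgebra
  -- The sections of the normalization over `U` are the integral closure of `Γ(Y, U)` in the
  -- function field, and `δ` is the inclusion.
  have hval := j.normalizationObjIso_hom_val hU
  have hδinj : Function.Injective δ.hom := by
    simp only [δ]
    rw [← hval, CommRingCat.hom_comp, CommRingCat.hom_comp]
    exact hε.1.comp (Subtype.val_injective.comp
      (j.normalizationObjIso hU).commRingCatIsoToRingEquiv.injective)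
  have hδ' : ∀ t, t ∈ integralClosure Γ(Y, U) Γ(Spec (Y.presheaf.stalk η), j ⁻¹ᵁ U) →
      ∃ c, δ.hom c = ε.hom t := by
    intro t ht
    obtain ⟨c, hc⟩ := (j.normalizationObjIso hU).commRingCatIsoToRingEquiv.surjective ⟨t, ht⟩
    refine ⟨c, congrArg ε.hom ?_⟩
    rw [← hval]
    exact congrArg Subtype.val hc
  have hγδ' : ∀ c, algebraMap O K (γ.hom c) = κ.hom (δ.hom c) := fun c => congr($(hγδ).hom c)
  have hγinj : Function.Injective γ.hom := by
    intro c c' h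
    apply hδinj
    apply hκ.1
    rw [← hγδ', ← hγδ', h]
  refine ⟨U, hU, hV, γ, hγ, hγinj, ?_, ?_⟩
  · intro b b' h
    have h1 : (j.app U ≫ ε).hom b = (j.app U ≫ ε).hom b' := by
      rw [← hcomp]
      exact congrArg δ.hom (hγinj h)
    have h2 := hε.1 h1
    rw [Scheme.fromSpecStalk_app hη] at h2
    have : Nonempty U := ⟨⟨η, hη⟩⟩
    refine germ_injective_of_isIntegral Y η hη ?_
    refine (ConcreteCategory.isIso_iff_bijective ((Scheme.ΓSpecIso (Y.presheaf.stalk η)).inv ≫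
      (Spec (Y.presheaf.stalk η)).presheaf.map (homOfLE (le_top (a := j ⁻¹ᵁ U))).op)).1 ?_ |>.1 h2
    rw [Subsingleton.elim (homOfLE (le_top (a := j ⁻¹ᵁ U))) (eqToHom hP)]
    infer_instance
  · rintro t N hN ⟨b, hb⟩
    obtain ⟨t', rfl⟩ := hκ.2 t
    obtain ⟨t', rfl⟩ := hε.2 t'
    have h1 : j.app U b = t' ^ N := by
      apply hε.1
      apply hκ.1
      rw [map_pow, map_pow, ← hb]
      refine Eq.trans ?_ (hγδ' _).symm
      exact congr(κ.hom ($(hcomp).hom b)).symm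
    obtain ⟨c, hc⟩ := hδ' t' (.of_pow hN (h1 ▸ isIntegral_algebraMap (x := b)))
    exact ⟨c, (hγδ' c).trans (congrArg κ.hom hc)⟩

/-! ### Divisors on the normalized blowup -/

theorem fromSpec_comp_eq_SpecMap {A : CommRingCat.{u}} {Y : Scheme.{u}} (f : Y ⟶ Spec A)
    {U : Y.Opens} (hU : IsAffineOpen U) :
    hU.fromSpec ≫ f = Spec.map ((Scheme.ΓSpecIso A).inv ≫ f.appLE ⊤ U le_top) := by
  rw [← IsAffineOpen.SpecMap_appLE_fromSpec f (isAffineOpen_top _) hU le_top,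
    IsAffineOpen.fromSpec_top, Spec.map_comp]
  congr 1
  rw [← cancel_epi (Spec A).isoSpec.hom, Iso.hom_inv_id, Scheme.isoSpec_Spec_hom, ← Spec.map_comp]
  simp

/-- The valuative criterion for the normalization of a proper birational model. -/
theorem exists_lift_normalization {R K : Type u} [CommRing R] [Field K] [Algebra R K]
    {Y : Scheme.{u}} [IsIntegral Y] [QuasiSeparatedSpace Y] (f : Y ⟶ Spec (CommRingCat.of R))
    [IsProper f] (κ : Y.presheaf.stalk (genericPoint Y) ⟶ CommRingCat.of K)
    (hκ : Spec.map κ ≫ Y.fromSpecStalk (genericPoint Y) ≫ f =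
      Spec.map (CommRingCat.ofHom (algebraMap R K)))
    {O : ValuationSubring K} (hRO : ∀ r, algebraMap R K r ∈ O) :
    ∃ g : Spec (CommRingCat.of O) ⟶ (Y.fromSpecStalk (genericPoint Y)).normalization,
      Spec.map (CommRingCat.ofHom (algebraMap O K)) ≫ g =
        Spec.map κ ≫ (Y.fromSpecStalk (genericPoint Y)).toNormalization ∧
      g ≫ normalizationMap Y ≫ f =
        Spec.map (CommRingCat.ofHom ((algebraMap R K).codRestrict O.toSubring hRO)) := by
  -- The normalization morphism is integral, hence universally closed; the lift needs only the
  -- existence part of the valuative criterion.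
  have h1 : UniversallyClosed ((Y.fromSpecStalk (genericPoint Y)).fromNormalization ≫ f) :=
    inferInstance
  rw [UniversallyClosed.eq_valuativeCriterion] at h1
  have hsq : CommSq (Spec.map κ ≫ (Y.fromSpecStalk (genericPoint Y)).toNormalization)
      (Spec.map (CommRingCat.ofHom (algebraMap O K)))
      ((Y.fromSpecStalk (genericPoint Y)).fromNormalization ≫ f)
      (Spec.map (CommRingCat.ofHom ((algebraMap R K).codRestrict O.toSubring hRO))) := by
    constructor
    rw [Category.assoc, Scheme.Hom.toNormalization_fromNormalization_assoc, hκ, ← Spec.map_comp]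
    rfl
  have h2 := (h1.1 { R := O, K := K, i₁ := _, i₂ := _, commSq := hsq }).exists_lift
  obtain ⟨g, hg1, hg2⟩ := h2
  exact ⟨g, hg1, hg2⟩

/-! ### Assembly of the flatness and lattice arguments -/

section Appears

variable {k : Type u} [Field k] {d : ℕ} {σ : PointedCone ℝ (Fin d → ℝ)}
  {χ : (Fin d → ℤ) → functionField k σ}

theorem appearsOn_normalizationMap (hadd : ∀ m m', χ (m + m') = χ m * χ m')
    (hχ : ∀ a : dualMonoid σ, χ a = algebraMap (coordRing k σ) _ (AddMonoidAlgebra.single a 1))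
    (hA : ∀ m : Fin d → ℤ, ∃ a ∈ dualMonoid σ, m + a ∈ dualMonoid σ)
    {O : ValuationSubring (functionField k σ)} {n ψ : Fin d → ℤ} (hψn : ψ ⬝ᵥ n = 1)
    (hψ : ψ ∈ dualMonoid σ) (hO : ∀ m : Fin d → ℤ, 0 ≤ m ⬝ᵥ n → χ m ∈ O) {l : ℕ} (hl : 0 < l)
    (hspan : ∀ m : Fin d → ℤ, m ⬝ᵥ n = 0 →
      ∃ N : ℕ, 0 < N ∧ N • m ∈ Submodule.span ℤ (minimalTranslations σ n l))
    {τ : PointedCone ℝ (Fin d → ℝ)} (hτσ : τ ≤ σ) (hτ : ∀ m ∈ dualMonoid τ, 0 ≤ m ⬝ᵥ n)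
    (φ : coordRing k τ →+* functionField k σ)
    (hφ : ∀ m c, φ (AddMonoidAlgebra.single m c) = c • χ m) (hφO : ∀ f, φ f ∈ O)
    (hfrac : ∀ o ∈ O, ∃ f s, O.valuation (φ s) = 1 ∧ o * φ s = φ f)
    {Y : Scheme.{u}} [IsIntegral Y] [QuasiSeparatedSpace Y] {f : Y ⟶ toricVariety k σ}
    (hf : IsProperBirational f) (hflat : ReducedPullbackFlat f (frobeniusLike k σ l)) :
    AppearsOn (normalizationMap Y ≫ f) O := by
  have hAO : ∀ r, algebraMap (coordRing k σ) (functionField k σ) r ∈ O := by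
    intro r
    induction r using coordRing_induction with
    | h0 => rw [map_zero]; exact zero_mem _
    | hadd f g hf hg => rw [map_add]; exact add_mem hf hg
    | hsingle m c =>
      rw [algebraMap_single hχ]
      have := hφO (AddMonoidAlgebra.single ⟨m, dualMonoid_anti hτσ m.2⟩ c)
      rwa [hφ] at this
  have := hf.proper
  obtain ⟨κ, hκ, hκf⟩ := exists_functionField_hom (K := functionField k σ) f hf.birational
  obtain ⟨g, hg, hgf⟩ := exists_lift_normalization f κ hκf hAO
  obtain ⟨U, hU, hV, γ, hγ, hγinj, hBinj, hint⟩ := exists_normalization_chart κ hκ g hg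
  obtain ⟨E, Q, inl, inr, ρ, hp, hρ, hker, hflat'⟩ :=
    exists_isPushout_of_reducedPullbackFlat hflat hU
  let ι : Γ(Y, U) →+* functionField k σ :=
    (algebraMap O (functionField k σ)).comp ((normalizationMap Y).app U ≫ γ).hom
  -- `S` and `T` are the coordinate rings, inside the function field, of an affine open of `Y` and
  -- of its preimage in the normalization.
  let S : Subring (functionField k σ) := ι.range
  let T : Subring (functionField k σ) := ((algebraMap O (functionField k σ)).comp γ.hom).range
  have hST : S ≤ T := by
    rintro _ ⟨b, rfl⟩
    exact ⟨((normalizationMap Y).app U).hom b, rfl⟩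
  have hιβ : ι.comp ((Scheme.ΓSpecIso (CommRingCat.of (coordRing k σ))).inv ≫
      f.appLE ⊤ U le_top).hom = algebraMap (coordRing k σ) (functionField k σ) := by
    have h1 : ((Scheme.ΓSpecIso (CommRingCat.of (coordRing k σ))).inv ≫ f.appLE ⊤ U le_top) ≫
        (normalizationMap Y).app U ≫ γ = CommRingCat.ofHom
          ((algebraMap (coordRing k σ) (functionField k σ)).codRestrict O.toSubring hAO) := by
      apply Spec.map_injective
      have h2 := IsAffineOpen.SpecMap_appLE_fromSpec (normalizationMap Y) hU hV le_rfl
      rw [← hgf, hγ]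
      refine Eq.symm ?_
      rw [Category.assoc, ← reassoc_of% h2, fromSpec_comp_eq_SpecMap,
        Scheme.Hom.app_eq_appLE]
      simp only [Spec.map_comp, Category.assoc]
    refine RingHom.ext fun r => ?_
    exact congr(algebraMap O (functionField k σ) ($(h1).hom r))
  have hS : ∀ r, algebraMap (coordRing k σ) _ r ∈ S := by
    intro r
    rw [← hιβ]
    exact ⟨_, rfl⟩
  have hW : ∀ w ∈ minimalTranslations σ n l, χ w ∈ localizationAtCenter O S := by
    intro w hw
    obtain ⟨b₁, b₂, hb₂, hb⟩ := exists_ratio_of_isPushout hadd hχ hA hO hl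
      ((Scheme.ΓSpecIso (CommRingCat.of (coordRing k σ))).inv ≫ f.appLE ⊤ U le_top)
      ((Scheme.ΓSpecIso (CommRingCat.of (coordRing k σ))).inv ≫ (frobeniusLike k σ l).appTop)
      (Scheme.ΓSpecIso (CommRingCat.of (coordRing k σ))).symm
      (Scheme.ΓSpecIso_inv_naturality _).symm inl inr
      (hp.of_iso (Scheme.ΓSpecIso _) (Iso.refl _) (Iso.refl _) (Iso.refl _) (by simp) (by simp)
        (by simp) (by simp))
      ρ hρ hker hflat' ι (Subtype.val_injective.comp hBinj) hιβ
      (fun b => Subtype.property _) hw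
    exact ⟨ι b₂, ⟨_, rfl⟩, hb₂, b₁, hb⟩
  have hT : ∀ m : Fin d → ℤ, 0 ≤ m ⬝ᵥ n → χ m ∈ localizationAtCenter O T := by
    intro m hm
    refine character_mem_localizationAtCenter hadd hχ hψn hψ hO (fun w hw => hw.1) hspan hS hST ?_
      hW hm
    rintro t N hN ⟨b, hb⟩
    exact hint t N hN ⟨b, hb⟩
  -- The localization of `T` at the center contains all monomials of the chart, whose localization
  -- is `O`; hence it contains `O`, and the local ring of the normalization is `O`.
  have hOT : ∀ o ∈ O, o ∈ localizationAtCenter O T := fun o ho =>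
    mem_localizationAtCenter_of_chart φ hφ hfrac (fun r => hST (hS r))
      (fun m hm => hT m (hτ m hm)) ho
  refine ⟨_, g, ?_, rfl, ?_⟩
  · rw [hgf, ← Spec.map_comp]
    rfl
  · rw [hγ]
    refine (isIso_stalkMap_comp_iff _ _ _).2 ((isIso_stalkMap_SpecMap_iff _).2 ?_)
    refine bijective_localRingHom γ.hom hγinj ?_
    intro o
    obtain ⟨_, ⟨s, rfl⟩, hs, c, hc⟩ := hOT o o.2
    refine ⟨c, s, ?_, ?_⟩
    · exact (O.valuation_eq_one_iff _).2 hs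
    · exact Subtype.ext hc.symm

end Appears

theorem sum_dualVector_dotProduct_basis {d : ℕ} (b : Module.Basis (Fin d) ℤ (Fin d → ℤ))
    (i : Fin d) : (∑ j, dualVector b j) ⬝ᵥ b i = 1 := by
  simp [sum_dotProduct, dualVector_dotProduct_basis]

/-- A bound that works for all rays of the maximal cones of a moderate subdivision. -/
theorem Fan.IsModerate.exists_bound {d : ℕ} {S : Fan d} {σ : PointedCone ℝ (Fin d → ℝ)}
    (hS : S.IsModerate σ) (hrat : IsRationalPolyhedral σ) :
    ∃ L : ℕ, ∀ τ ∈ S.cones, IsNondegenerate τ →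
      ∃ b : Module.Basis (Fin d) ℤ (Fin d → ℤ),
        τ = PointedCone.hull ℝ (Set.range fun i => toReal (b i)) ∧ SupportsVertex b σ ∧
        ∀ i l, L ≤ l → ∀ m : Fin d → ℤ, m ⬝ᵥ b i = 0 →
          ∃ N : ℕ, 0 < N ∧ N • m ∈ Submodule.span ℤ (minimalTranslations σ (b i) l) := by
  have key : ∀ τ ∈ S.cones, ∃ L : ℕ, IsNondegenerate τ →
      ∃ b : Module.Basis (Fin d) ℤ (Fin d → ℤ),
        τ = PointedCone.hull ℝ (Set.range fun i => toReal (b i)) ∧ SupportsVertex b σ ∧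
        ∀ i l, L ≤ l → ∀ m : Fin d → ℤ, m ⬝ᵥ b i = 0 →
          ∃ N : ℕ, 0 < N ∧ N • m ∈ Submodule.span ℤ (minimalTranslations σ (b i) l) := by
    intro τ hτ
    by_cases hnd : IsNondegenerate τ
    · obtain ⟨b, hb, hsupp⟩ := hS.2 τ hτ hnd
      have hmem : ∀ i, toReal (b i) ∈ σ := by
        intro i
        rw [← SetLike.mem_coe, ← hS.1]
        refine Set.mem_biUnion hτ ?_
        rw [hb]
        exact PointedCone.subset_hull ⟨i, rfl⟩
      choose L hL using fun i => exists_smul_mem_span_minimalTranslations hrat (hmem i)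
        (sum_dualVector_dotProduct_basis b i) hsupp.pos
      exact ⟨Finset.univ.sup L, fun _ => ⟨b, hb, hsupp, fun i l hl =>
        hL i l ((Finset.le_sup (Finset.mem_univ i)).trans hl)⟩⟩
    · exact ⟨0, fun h => absurd h hnd⟩
  choose! L hL using key
  -- The fan is finite, so one bound serves all its rays and thus all essential divisors at once.
  obtain ⟨M, hM⟩ := (S.finite.image L).bddAbove
  refine ⟨M, fun τ hτ hnd => ?_⟩
  obtain ⟨b, hb, hsupp, hspan⟩ := hL τ hτ hnd
  exact ⟨b, hb, hsupp, fun i l hl => hspan i l ((hM ⟨τ, hτ, rfl⟩).trans hl)⟩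

end FBlowup

end

theorem mainTheorem2 (k : Type u) [Field k] (d : ℕ) (σ : PointedCone ℝ (Fin d → ℝ))
    (hrat : FBlowup.IsRationalPolyhedral σ) (hconv : FBlowup.IsStronglyConvex σ)
    (hdim : FBlowup.IsNondegenerate σ)
    (hmod : ∃ S : FBlowup.Fan d, S.IsModerate σ) :
    ∃ l₀ : ℕ, 0 < l₀ ∧ ∀ l : ℕ, l₀ ≤ l →
      ∀ (Y : Scheme.{u}) [IsIntegral Y] [QuasiSeparatedSpace Y]
        (f : Y ⟶ FBlowup.toricVariety k σ), FBlowup.IsFBlowup l f →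
        ∀ O : ValuationSubring (FBlowup.functionField k σ), FBlowup.IsBGSEssential O →
          FBlowup.AppearsOn (FBlowup.normalizationMap Y ≫ f) O := by
  open FBlowup in
  obtain ⟨S, hS⟩ := hmod
  obtain ⟨L, hL⟩ := hS.exists_bound hrat
  -- The `+ 1` makes `l` positive, so that multiplication by `l` is injective on `A`.
  refine ⟨L + 1, L.succ_pos, fun l hl Y _ _ f hf O hO => ?_⟩
  -- Essentiality is used for this one resolution only. The divisor appears on a face `τ` of a
  -- full-dimensional `τ'`, whose basis supplies `ψ`.
  obtain ⟨τ, ⟨-, τ', hτ', hnd, hface⟩, hτσ, z, hz⟩ :=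
    hO.2 S.pureSubfan (hS.isSmoothSubdivision_pureSubfan hdim)
  obtain ⟨b, rfl, hsupp, hspan⟩ := hL τ' hτ' hnd
  obtain ⟨s, hs⟩ := IsFaceOf.eq_hull hface
  have hpos := hsupp.pos
  have hψ : ∑ j, dualVector b j ∈ dualMonoid σ := by
    rw [mem_dualMonoid]
    intro x hx
    rcases eq_or_ne x 0 with rfl | h0
    · simp
    · exact (hpos x hx h0).le
  have hA : ∀ m : Fin d → ℤ, ∃ a ∈ dualMonoid σ, m + a ∈ dualMonoid σ := by
    intro m
    obtain ⟨N, hN⟩ := exists_add_nsmul_mem hrat hpos m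
    exact ⟨_, nsmul_mem hψ N, hN⟩
  obtain ⟨χ, hadd, hχ⟩ := exists_character k hA
  obtain ⟨φ, hφ, hφO, -, hfrac⟩ := exists_chart_hom hadd hχ hA hτσ hz
  obtain ⟨i, hi, hOi⟩ := exists_ray_of_appearsAt hadd hχ hA hO.1 b s hs hτσ φ hφ hφO hfrac
  refine appearsOn_normalizationMap hadd hχ hA (sum_dualVector_dotProduct_basis b i) hψ hOi
    (by lia) (hspan i l (by lia)) hτσ ?_ φ hφ hφO hfrac hf.properBirational hf.flat
  intro m hm
  rw [hs, show (fun i => toReal (b i)) '' s = toReal '' (b '' s) by rw [Set.image_image],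
    mem_dualMonoid_hull] at hm
  exact hm _ ⟨i, hi, rfl⟩
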